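/- Let $n\ge 1$ and let $J$ be the bounded self-adjoint Jacobi operator on $\ell^2(\mathbb N)$, $\mathbb N=\{1,2,\dots\}$, with diagonal entries $2,2,2,\dots$ and off-diagonal entries $-\sqrt2,-1,-1,\dots$; its continuous spectrum is $[0,4]$. For $\mu=(\mu_1,\dots,\mu_n)\in\mathbb R^n$ put $$H_\mu=J+V_\mu,\qquad V_\mu=\mathrm{diag}(2\mu_1,\mu_2,\dots,\mu_n,0,0,\dots).$$ Let $E_{A}(\cdot)$ denote the spectral measure of a self-adjoint operator $A$. The operator $H_\mu$ is called critical at the lower (resp. upper) threshold if the function $$\mathbb R^n\ni\nu\mapsto \mathrm{tr}\,E_{H_\nu}((-\infty,0))\qquad(\text{resp. } \nu\mapsto\mathrm{tr}\,E_{H_\nu}((4,\infty)))$$ is discontinuous at $\nu=\mu$, and noncritical (no threshold is a virtual level) if it is critical at neither threshold. Define polynomials by $Q_0=1$, $Q_1(\mu_1)=1+\mu_1$, $Q_{m+1}=(2+\mu_{m+1})Q_m-Q_{m-1}$ for $m\ge1$, where $Q_m=Q_m(\mu_1,\dots,\mu_m)$, and rational functions $\Phi_m=Q_{m-1}/Q_m-2$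 on $\{Q_m\neq0\}\subset\mathbb R^m$, $m\ge 1$. Define sets $D_k^{(m)}\subset\mathbb R^m$, $0\le k\le m$, by $D_0^{(1)}=(-1,\infty)$, $D_1^{(1)}=(-\infty,-1)$ and, for $m\ge1$, $$D_0^{(m+1)}=U_0^{(m)},\qquad D_k^{(m+1)}=L_{k-1}^{(m)}\cup\big(\Gamma_{k-1}^{(m-1)}\times\mathbb R\big)\cup U_k^{(m)}\ (1\le k\le m),\qquad D_{m+1}^{(m+1)}=L_m^{(m)},$$ where $U_k^{(m)}$, $L_k^{(m)}$ and $\Gamma_k^{(m)}$ are the open epigraph, the open hypograph and the graph of $\Phi_m$ restricted to $D_k^{(m)}$, and $\Gamma_0^{(0)}=\{-1\}$. Finally put $$G_k^{(n)}=(0,\dots,0,1)+D_k^{(n)},\qquad 0\le k\le n.$$ Suppose that $H_\mu$ is noncritical. Then all eigenvalues of $H_\mu$ in $(-\infty,0)\cup(4,\infty)$ are simple, and (i) for every $0\le k\le n$, $H_\mu$ has exactly $k$ negative eigenvalues if and only if $\mu\in G_k^{(n)}$; (ii) for every $0\le \ell\le n$, $H_\mu$ has exactly $\ell$ eigenvalues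 in $(4,\infty)$ if and only if $-\mu\in G_\ell^{(n)}$. Moreover, for every $\mu\in\mathbb R^n$ and all $0\le k,\ell\le n$: $\mu\in G_k^{(n)}\cap(-G_\ell^{(n)})$ if and only if $k+\ell\le n$, $H_\mu$ is noncritical, and $H_\mu$ has exactly $k$ eigenvalues in $(-\infty,0)$ and exactly $\ell$ eigenvalues in $(4,\infty)$. -/

import Mathlib

open scoped Pointwise

noncomputable section

namespace JacobiVirtual

/-! ### Jacobi operators on the Hilbert space of square-summable sequences

Lattice sites are numbered from `0`, so that site `m` here is site `m + 1` in the numbering that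
starts from `1`. -/

/-- The complex Hilbert space of square-summable sequences. -/
abbrev L2 : Type := lp (fun _ : ℕ => ℂ) 2

/-- The action on sequences of the Jacobi matrix with diagonal entries `b 0, b 1, …` and
off-diagonal entries `a 0, a 1, …`, where `a m` couples the sites `m` and `m + 1`. -/
def jacobiFun (a b : ℕ → ℝ) (u : ℕ → ℂ) : ℕ → ℂ
  | 0 => b 0 * u 0 + a 0 * u 1
  | m + 1 => a m * u m + b (m + 1) * u (m + 1) + a (m + 1) * u (m + 2)

theorem summable_sq (u : L2) : Summable fun m => ‖u m‖ ^ 2 := by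
  have h := (lp.memℓp u).summable (by norm_num)
  simpa using h

theorem norm_sq (u : L2) : ‖u‖ ^ 2 = ∑' m, ‖u m‖ ^ 2 := by
  have h := lp.norm_rpow_eq_tsum (p := 2) (by norm_num) u
  simpa using h

theorem sq_add_three (x y z : ℝ) : (x + y + z) ^ 2 ≤ 3 * (x ^ 2 + y ^ 2 + z ^ 2) := by
  nlinarith [sq_nonneg (x - y), sq_nonneg (y - z), sq_nonneg (x - z)]

theorem norm_coeff_mul_le {C c : ℝ} (hc : |c| ≤ C) (z : ℂ) : ‖(c : ℂ) * z‖ ≤ C * ‖z‖ := by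
  rw [norm_mul, Complex.norm_real, Real.norm_eq_abs]
  exact mul_le_mul_of_nonneg_right hc (norm_nonneg _)

/-- The sequence `u` moved one step to the right, in absolute values. -/
def prevSq (u : ℕ → ℂ) : ℕ → ℝ
  | 0 => 0
  | m + 1 => ‖u m‖ ^ 2

theorem jacobiFun_sq_le {a b : ℕ → ℝ} {C : ℝ} (ha : ∀ m, |a m| ≤ C) (hb : ∀ m, |b m| ≤ C)
    (u : ℕ → ℂ) (m : ℕ) :
    ‖jacobiFun a b u m‖ ^ 2 ≤
      3 * C ^ 2 * (prevSq u m + ‖u m‖ ^ 2 + ‖u (m + 1)‖ ^ 2) := by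
  cases m with
  | zero =>
    have h1 := norm_add_le ((b 0 : ℂ) * u 0) ((a 0 : ℂ) * u 1)
    have h2 := norm_coeff_mul_le (hb 0) (u 0)
    have h3 := norm_coeff_mul_le (ha 0) (u 1)
    have h4 := sq_add_three 0 (C * ‖u 0‖) (C * ‖u 1‖)
    have h5 : ‖jacobiFun a b u 0‖ ^ 2 ≤ (0 + C * ‖u 0‖ + C * ‖u 1‖) ^ 2 :=
      pow_le_pow_left₀ (norm_nonneg _) (by simp only [jacobiFun]; linarith) 2
    simp only [prevSq]
    nlinarith
  | succ m =>
    have h1 := norm_add₃_le (a := (a m : ℂ) * u m) (b := (b (m + 1) : ℂ) * u (m + 1))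
      (c := (a (m + 1) : ℂ) * u (m + 2))
    have h2 := norm_coeff_mul_le (ha m) (u m)
    have h3 := norm_coeff_mul_le (hb (m + 1)) (u (m + 1))
    have h3' := norm_coeff_mul_le (ha (m + 1)) (u (m + 2))
    have h4 := sq_add_three (C * ‖u m‖) (C * ‖u (m + 1)‖) (C * ‖u (m + 2)‖)
    have h5 : ‖jacobiFun a b u (m + 1)‖ ^ 2 ≤
        (C * ‖u m‖ + C * ‖u (m + 1)‖ + C * ‖u (m + 2)‖) ^ 2 :=
      pow_le_pow_left₀ (norm_nonneg _) (by simp only [jacobiFun]; linarith) 2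
    simp only [prevSq]
    nlinarith

theorem summable_prevSq (u : L2) : Summable (prevSq u) :=
  (summable_nat_add_iff 1).1 (summable_sq u)

theorem tsum_prevSq (u : L2) : ∑' m, prevSq u m = ‖u‖ ^ 2 := by
  rw [(summable_prevSq u).tsum_eq_zero_add, norm_sq]
  simp [prevSq]

theorem tsum_nextSq_le (u : L2) : ∑' m, ‖u (m + 1)‖ ^ 2 ≤ ‖u‖ ^ 2 := by
  rw [norm_sq, (summable_sq u).tsum_eq_zero_add]
  have := sq_nonneg ‖u 0‖
  linarith

theorem summable_bound (C : ℝ) (u : L2) :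
    Summable fun m => 3 * C ^ 2 * (prevSq u m + ‖u m‖ ^ 2 + ‖u (m + 1)‖ ^ 2) :=
  (((summable_prevSq u).add (summable_sq u)).add
    ((summable_nat_add_iff 1).2 (summable_sq u))).mul_left _

theorem jacobiFun_memℓp {a b : ℕ → ℝ} {C : ℝ} (ha : ∀ m, |a m| ≤ C) (hb : ∀ m, |b m| ≤ C)
    (u : L2) : Memℓp (jacobiFun a b u) 2 := by
  refine memℓp_gen ?_
  have h : Summable fun m => ‖jacobiFun a b u m‖ ^ 2 :=
    Summable.of_nonneg_of_le (fun _ => sq_nonneg _) (jacobiFun_sq_le ha hb u)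
      (summable_bound C u)
  simpa using h

/-- The Jacobi matrix with bounded entries as a linear map. -/
def jacobiLin (a b : ℕ → ℝ) (C : ℝ) (ha : ∀ m, |a m| ≤ C) (hb : ∀ m, |b m| ≤ C) :
    L2 →ₗ[ℂ] L2 where
  toFun u := ⟨jacobiFun a b u, jacobiFun_memℓp ha hb u⟩
  map_add' u v := by
    ext m
    change jacobiFun a b (u + v : L2) m = jacobiFun a b u m + jacobiFun a b v m
    cases m <;> simp [jacobiFun] <;> ring
  map_smul' c u := by
    ext m
    change jacobiFun a b (c • u : L2) m = c * jacobiFun a b u m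
    cases m <;> simp [jacobiFun] <;> ring

theorem norm_jacobiLin_le (a b : ℕ → ℝ) (C : ℝ) (ha : ∀ m, |a m| ≤ C) (hb : ∀ m, |b m| ≤ C)
    (u : L2) : ‖jacobiLin a b C ha hb u‖ ≤ 3 * C * ‖u‖ := by
  have hC : 0 ≤ C := (abs_nonneg _).trans (ha 0)
  refine le_of_sq_le_sq ?_ (by positivity)
  have hs : Summable fun m => ‖jacobiFun a b u m‖ ^ 2 := summable_sq (jacobiLin a b C ha hb u)
  calc ‖jacobiLin a b C ha hb u‖ ^ 2 = ∑' m, ‖jacobiFun a b u m‖ ^ 2 := norm_sq _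
    _ ≤ ∑' m, 3 * C ^ 2 * (prevSq u m + ‖u m‖ ^ 2 + ‖u (m + 1)‖ ^ 2) :=
        hs.tsum_le_tsum (jacobiFun_sq_le ha hb u) (summable_bound C u)
    _ = 3 * C ^ 2 * (∑' m, prevSq u m + ∑' m, ‖u m‖ ^ 2 + ∑' m, ‖u (m + 1)‖ ^ 2) := by
        rw [tsum_mul_left, Summable.tsum_add, Summable.tsum_add]
        · exact summable_prevSq u
        · exact summable_sq u
        · exact (summable_prevSq u).add (summable_sq u)
        · exact (summable_nat_add_iff 1).2 (summable_sq u)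
    _ ≤ 3 * C ^ 2 * (‖u‖ ^ 2 + ‖u‖ ^ 2 + ‖u‖ ^ 2) := by
        rw [tsum_prevSq, ← norm_sq]
        gcongr
        exact tsum_nextSq_le u
    _ = (3 * C * ‖u‖) ^ 2 := by ring

/-- The Jacobi matrix with bounded entries as a bounded operator. -/
def jacobiOp (a b : ℕ → ℝ) (C : ℝ) (ha : ∀ m, |a m| ≤ C) (hb : ∀ m, |b m| ≤ C) :
    L2 →L[ℂ] L2 :=
  (jacobiLin a b C ha hb).mkContinuous (3 * C) (norm_jacobiLin_le a b C ha hb)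

/-- The off-diagonal entries `-√2, -1, -1, …` of the free Jacobi matrix. -/
def offDiag (m : ℕ) : ℝ := if m = 0 then -√2 else -1

theorem abs_offDiag_le (m : ℕ) : |offDiag m| ≤ 2 := by
  have h : √2 ≤ 2 := by
    rw [Real.sqrt_le_left (by norm_num)]
    norm_num
  unfold offDiag
  split_ifs
  · rw [abs_neg, abs_of_nonneg (Real.sqrt_nonneg 2)]
    exact h
  · norm_num

/-- The free Jacobi operator: diagonal `2, 2, 2, …`, off-diagonal `-√2, -1, -1, …`. -/
def J : L2 →L[ℂ] L2 :=
  jacobiOp offDiag (fun _ => 2) 2 abs_offDiag_le (fun _ => by norm_num)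

/-- The diagonal entries `2 μ₁, μ₂, …, μₙ, 0, 0, …` of the potential. -/
def potential {n : ℕ} (μ : Fin n → ℝ) (m : ℕ) : ℝ :=
  if h : m < n then (if m = 0 then 2 * μ ⟨m, h⟩ else μ ⟨m, h⟩) else 0

theorem abs_potential_le {n : ℕ} (μ : Fin n → ℝ) (m : ℕ) :
    |potential μ m| ≤ ∑ i, 2 * |μ i| := by
  have h0 : 0 ≤ ∑ i, 2 * |μ i| := Finset.sum_nonneg fun i _ => by positivity
  unfold potential
  split_ifs with h h'
  · rw [abs_mul, abs_two]
    exact Finset.single_le_sum (f := fun i => 2 * |μ i|) (fun i _ => by positivity)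
      (Finset.mem_univ (⟨m, h⟩ : Fin n))
  · have := Finset.single_le_sum (f := fun i => 2 * |μ i|) (fun i _ => by positivity)
      (Finset.mem_univ (⟨m, h⟩ : Fin n))
    have h2 := abs_nonneg (μ ⟨m, h⟩)
    linarith
  · simpa using h0

/-- The potential `V_μ = diag(2 μ₁, μ₂, …, μₙ, 0, 0, …)`. -/
def V {n : ℕ} (μ : Fin n → ℝ) : L2 →L[ℂ] L2 :=
  jacobiOp (fun _ => 0) (potential μ) (∑ i, 2 * |μ i|)
    (fun _ => by simpa using Finset.sum_nonneg fun i _ => by positivity) (abs_potential_le μ)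

/-- The operator `H_μ = J + V_μ`. -/
def H {n : ℕ} (μ : Fin n → ℝ) : L2 →L[ℂ] L2 := J + V μ

/-! ### Eigenvalues, spectral projections and critical operators -/

/-- The real number `z` is an eigenvalue of `A`. -/
def IsEigenvalue (A : L2 →L[ℂ] L2) (z : ℝ) : Prop :=
  Module.End.HasEigenvalue (A : Module.End ℂ L2) (z : ℂ)

/-- The multiplicity of the eigenvalue `z` of `A` is one. -/
def IsSimpleEigenvalue (A : L2 →L[ℂ] L2) (z : ℝ) : Prop :=
  Module.finrank ℂ (Module.End.eigenspace (A : Module.End ℂ L2) (z : ℂ)) = 1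

/-- `A` has exactly `k` (distinct) eigenvalues in `S`. -/
def HasExactlyEigenvaluesIn (A : L2 →L[ℂ] L2) (S : Set ℝ) (k : ℕ) : Prop :=
  {z : ℝ | z ∈ S ∧ IsEigenvalue A z}.encard = k

/-- For bounded self-adjoint `A` and continuous real `f`, the closure of the range of `f(A)` is the range
of the spectral projection `E_A({x | f x ≠ 0})`; this is its dimension, that is, the trace
`tr E_A({x | f x ≠ 0})`, with value `⊤` when it is infinite. -/
def traceSpectralProj {E : Type*} [NormedAddCommGroup E] [InnerProductSpace ℂ E] [CompleteSpace E]
    (A : E →L[ℂ] E) (f : ℝ → ℝ) : ℕ∞ :=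
  Cardinal.toENat (Module.rank ℂ (cfc f A : E →L[ℂ] E).range.topologicalClosure)

/-- `tr E_A((-∞, 0))` for self-adjoint `A`. -/
def traceBelow (A : L2 →L[ℂ] L2) : ℕ∞ := traceSpectralProj A fun x => max (0 - x) 0

/-- `tr E_A((4, ∞))` for self-adjoint `A`. -/
def traceAbove (A : L2 →L[ℂ] L2) : ℕ∞ := traceSpectralProj A fun x => max (x - 4) 0

/-- `H_μ` is critical at the lower threshold `0` of the continuous spectrum `[0, 4]`: the dimension
of the spectral subspace below the threshold is, as a function of the potential supported on the
first `n` sites, discontinuous at `μ`. -/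
def CriticalLower {n : ℕ} (μ : Fin n → ℝ) : Prop :=
  ¬ ContinuousAt (fun ν : Fin n → ℝ => traceBelow (H ν)) μ

/-- `H_μ` is critical at the upper threshold `4` of the continuous spectrum. -/
def CriticalUpper {n : ℕ} (μ : Fin n → ℝ) : Prop :=
  ¬ ContinuousAt (fun ν : Fin n → ℝ => traceAbove (H ν)) μ

/-- Neither threshold is a virtual level of `H_μ`. -/
def Noncritical {n : ℕ} (μ : Fin n → ℝ) : Prop := ¬ CriticalLower μ ∧ ¬ CriticalUpper μ

/-! ### The regions of the parameter space -/

/-- The polynomials `Q₀ = 1`, `Q₁ = 1 + μ₁`, `Q_{n+2} = (2 + μ_{n+2}) Q_{n+1} - Q_n`, where `Q_n`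
depends on `μ₁, …, μₙ`. -/
def Q : (n : ℕ) → (Fin n → ℝ) → ℝ
  | 0, _ => 1
  | 1, μ => 1 + μ 0
  | n + 2, μ => (2 + μ (Fin.last (n + 1))) * Q (n + 1) (Fin.init μ) - Q n (Fin.init (Fin.init μ))

/-- The rational function `Φ_n = Q_{n-1} / Q_n - 2`, to be used where `Q_n ≠ 0`. For `n = 0` it is
the constant `-1`, so that its graph is the zero set of `Q₁`. -/
def Phi : (n : ℕ) → (Fin n → ℝ) → ℝ
  | 0, _ => -1
  | n + 1, μ => Q n (Fin.init μ) / Q (n + 1) μ - 2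

/-- The open epigraph of `f` restricted to `D`. -/
def epi {n : ℕ} (f : (Fin n → ℝ) → ℝ) (D : Set (Fin n → ℝ)) : Set (Fin (n + 1) → ℝ) :=
  {w | Fin.init w ∈ D ∧ f (Fin.init w) < w (Fin.last n)}

/-- The open hypograph of `f` restricted to `D`. -/
def hypo {n : ℕ} (f : (Fin n → ℝ) → ℝ) (D : Set (Fin n → ℝ)) : Set (Fin (n + 1) → ℝ) :=
  {w | Fin.init w ∈ D ∧ w (Fin.last n) < f (Fin.init w)}

/-- The graph of `f` restricted to `D`. -/
def graph {n : ℕ} (f : (Fin n → ℝ) → ℝ) (D : Set (Fin n → ℝ)) : Set (Fin (n + 1) → ℝ) :=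
  {w | Fin.init w ∈ D ∧ w (Fin.last n) = f (Fin.init w)}

/-- The cylinder `D × ℝ`. -/
def cylinder {n : ℕ} (D : Set (Fin n → ℝ)) : Set (Fin (n + 1) → ℝ) := {w | Fin.init w ∈ D}

/-- The connected components `D_k^{(n)}`, `0 ≤ k ≤ n`, of the domain `{Q_n ≠ 0}` of `Φ_n`.
`D_0^{(n+1)}` is the epigraph of `Φ_n` over `D_0^{(n)}`, and `D_{k+1}^{(n+1)}` is the hypograph of
`Φ_n` over `D_k^{(n)}` joined with the epigraph of `Φ_n` over `D_{k+1}^{(n)}` along their shared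
boundary, the cylinder over the graph of `Φ_{n-1}` over `D_k^{(n-1)}`. The convention
`D_k^{(n)} = ∅` for `k > n` reduces this for `k = n` to the hypograph of `Φ_n` over `D_n^{(n)}`. The
one-point space is used only for the first of these graphs, the point `-1` of the line. -/
def D : (n : ℕ) → ℕ → Set (Fin n → ℝ)
  | 0, 0 => Set.univ
  | 0, _ + 1 => ∅
  | 1, 0 => {μ | -1 < μ 0}
  | 1, 1 => {μ | μ 0 < -1}
  | 1, _ + 2 => ∅
  | n + 2, 0 => epi (Phi (n + 1)) (D (n + 1) 0)
  | n + 2, k + 1 =>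
      hypo (Phi (n + 1)) (D (n + 1) k) ∪ cylinder (graph (Phi n) (D n k)) ∪
        epi (Phi (n + 1)) (D (n + 1) (k + 1))

/-- The vector `(0, …, 0, 1)`. -/
def lastUnit (n : ℕ) : Fin n → ℝ := fun i => if (i : ℕ) + 1 = n then 1 else 0

/-- The region `G_k^{(n)} = (0, …, 0, 1) + D_k^{(n)}`. -/
def G (n k : ℕ) : Set (Fin n → ℝ) := {μ | μ - lastUnit n ∈ D n k}

end JacobiVirtual

end

/-!
Multiply the first coordinate of a sequence by `√2`. Then the quadratic form of `H μ` becomes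
`∑ |w (m + 1) - w m|² + ∑ μ m |w m|²`, the limit of forms `triForm` of finite tridiagonal matrices
whose leading minors are the values `Q_m` of the solution of the threshold equation `H μ u = 0`.
Completing squares turns ratios of consecutive minors into pivots, so that `triForm a n` has
negative index equal to the number of sign changes of `Q_0, …, Q_n` whenever `Q_n ≠ 0`; an
intermediate zero of `Q` contributes a hyperbolic plane (`hasNegDim_changes`,
`hasNonnegCodim_changes`). The recursive description of the regions `D n k` says precisely that
`Q_n ≠ 0` and that there are `k` sign changes (`mem_D_iff`).

Beyond the support of the potential the threshold solution is affine. If its slope `Q_n - Q_{n-1}`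
is nonzero, which is `Q_n` at `μ - (0, …, 0, 1)`, then the sign changes on long finite intervals
are as many as those of `Q_0, …, Q_{n-1}` followed by the slope. Long intervals bound the negative
index of `H μ` from below, and the first `n` sites, with the bond behind them cut, bound it from
above. The two bounds agree (`hasNegIndex_H`), so the index is `k` exactly for `μ ∈ G n k`. For any
self-adjoint operator the negative index of the form is the dimension of the spectral subspace of
`(-∞, 0)`, and by simplicity of the eigenvalues, which a three-term recurrence forces, also their
number (`HasNegIndex.traceSpectralProj_eq`, `HasNegIndex.encard_eigenvalues`).

The number of sign changes is locally constant where the slope does not vanish. Where it vanishes,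
shifting the last parameter in the two directions gives two different numbers, so the criticality of
the lower threshold is the vanishing of the slope (`continuousAt_iff_slope_ne_zero`). The upper
threshold reduces to the lower one by the unitary `u m ↦ (-1)^m u m`, which carries `4 - H μ` to
`H (-μ)`. Finally `k + l ≤ n`, because the two finite forms that count `k` and `l` add up to a
nonnegative form, so that their negative subspaces of `ℂ^n` are independent.
-/

noncomputable section

namespace JacobiVirtual

/-! ### The negative index of a self-adjoint operator -/

section NegIndex

variable {E : Type*} [NormedAddCommGroup E] [InnerProductSpace ℂ E]

/-- The quadratic form of `A` has negative index `k`: it is negative definite on a `k`-dimensional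
subspace, given as the image of `ℂ^k`, and nonnegative on a subspace of codimension at most `k`,
given as the kernel of a map to `ℂ^k`. -/
def HasNegIndex (A : E →L[ℂ] E) (k : ℕ) : Prop :=
  (∃ e : (Fin k → ℂ) →ₗ[ℂ] E, ∀ x, x ≠ 0 → A.reApplyInnerSelf (e x) < 0) ∧
    ∃ l : E →ₗ[ℂ] (Fin k → ℂ), ∀ u, l u = 0 → 0 ≤ A.reApplyInnerSelf u

theorem reApplyInnerSelf_of_eigen {A : E →L[ℂ] E} {z : ℝ} {u : E} (hu : A u = (z : ℂ) • u) :
    A.reApplyInnerSelf u = z * ‖u‖ ^ 2 := by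
  rw [ContinuousLinearMap.reApplyInnerSelf_apply, hu, inner_smul_left, Complex.conj_ofReal,
    inner_self_eq_norm_sq_to_K]
  change Complex.re ((z : ℂ) * (‖u‖ : ℂ) ^ 2) = _
  rw [← Complex.ofReal_pow, ← Complex.ofReal_mul, Complex.ofReal_re]

variable [CompleteSpace E]

/-- The spectral subspace of `A` for `(-∞, 0)`, in the form in which `traceSpectralProj` uses it. -/
def negSubspace (A : E →L[ℂ] E) : Submodule ℂ E :=
  (cfc (fun x : ℝ => max (0 - x) 0) A : E →L[ℂ] E).range.topologicalClosure

instance (A : E →L[ℂ] E) : (negSubspace A).HasOrthogonalProjection := by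
  have : IsClosed (negSubspace A : Set E) := Submodule.isClosed_topologicalClosure _
  have := this.completeSpace_coe
  exact Submodule.HasOrthogonalProjection.ofCompleteSpace _

/-- The square root of the negative part of `A`. -/
def sqrtNeg (A : E →L[ℂ] E) : E →L[ℂ] E := cfc (fun x : ℝ => √(max (0 - x) 0)) A

/-- The square root of the positive part of `A`. -/
def sqrtPos (A : E →L[ℂ] E) : E →L[ℂ] E := cfc (fun x : ℝ => √(max x 0)) A

theorem negSubspace_eq (A : E →L[ℂ] E) :
    negSubspace A = (sqrtNeg A * sqrtNeg A).range.topologicalClosure := by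
  unfold negSubspace sqrtNeg
  rw [← cfc_mul _ _ A (by fun_prop) (by fun_prop)]
  simp only [Real.mul_self_sqrt (le_max_right _ _)]

theorem sqrtPos_mul_sqrtNeg (A : E →L[ℂ] E) : sqrtPos A * sqrtNeg A = 0 := by
  unfold sqrtPos sqrtNeg
  rw [← cfc_mul _ _ A (by fun_prop) (by fun_prop)]
  convert cfc_zero ℝ A using 2
  ext x
  rcases le_total x 0 with h | h
  · simp [h]
  · simp [h]

theorem inner_sqrtNeg_left (A : E →L[ℂ] E) (u v : E) :
    inner ℂ (sqrtNeg A u) v = inner ℂ u (sqrtNeg A v) :=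
  (show IsSelfAdjoint (sqrtNeg A) from cfc_predicate _ A).isSymmetric u v

theorem inner_sqrtPos_left (A : E →L[ℂ] E) (u v : E) :
    inner ℂ (sqrtPos A u) v = inner ℂ u (sqrtPos A v) :=
  (show IsSelfAdjoint (sqrtPos A) from cfc_predicate _ A).isSymmetric u v

variable {A : E →L[ℂ] E}

theorem sqrtPos_sq_sub_sqrtNeg_sq (hA : IsSelfAdjoint A) :
    sqrtPos A * sqrtPos A - sqrtNeg A * sqrtNeg A = A := by
  unfold sqrtPos sqrtNeg
  rw [← cfc_mul _ _ A (by fun_prop) (by fun_prop), ← cfc_mul _ _ A (by fun_prop) (by fun_prop),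
    ← cfc_sub _ _ A (by fun_prop) (by fun_prop)]
  refine Eq.trans ?_ (cfc_id' ℝ A)
  congr 1
  ext x
  simp only [Real.mul_self_sqrt (le_max_right _ _)]
  rcases le_total x 0 with h | h <;> simp [h]

theorem reApplyInnerSelf_eq (hA : IsSelfAdjoint A) (u : E) :
    A.reApplyInnerSelf u = ‖sqrtPos A u‖ ^ 2 - ‖sqrtNeg A u‖ ^ 2 := by
  have h := sqrtPos_sq_sub_sqrtNeg_sq hA
  have hu : A u = sqrtPos A (sqrtPos A u) - sqrtNeg A (sqrtNeg A u) := by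
    conv_lhs => rw [← h]
    simp
  rw [ContinuousLinearMap.reApplyInnerSelf_apply, hu, inner_sub_left, inner_sqrtPos_left,
    inner_sqrtNeg_left, map_sub, ← norm_sq_eq_re_inner, ← norm_sq_eq_re_inner]

theorem sqrtNeg_commute (hA : IsSelfAdjoint A) (u : E) : sqrtNeg A (A u) = A (sqrtNeg A u) := by
  have h := cfc_commute_cfc (fun x : ℝ => √(max (0 - x) 0)) (fun x : ℝ => x) A
  rw [cfc_id' ℝ A] at h
  exact congrArg (fun T : E →L[ℂ] E => T u) h.eq

/-- On the negative spectral subspace the positive part vanishes, because it annihilates the range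
of the negative part. -/
theorem sqrtPos_eq_zero_of_mem {u : E} (hu : u ∈ negSubspace A) : sqrtPos A u = 0 := by
  rw [negSubspace_eq] at hu
  have hle : (sqrtNeg A * sqrtNeg A).range.topologicalClosure ≤ (sqrtPos A).ker := by
    refine Submodule.topologicalClosure_minimal _ ?_ (sqrtPos A).isClosed_ker
    rintro _ ⟨v, rfl⟩
    change sqrtPos A (sqrtNeg A (sqrtNeg A v)) = 0
    exact congrArg (fun T : E →L[ℂ] E => T (sqrtNeg A v)) (sqrtPos_mul_sqrtNeg A)
  exact hle hu

theorem mem_orthogonal_negSubspace_iff {u : E} : u ∈ (negSubspace A)ᗮ ↔ sqrtNeg A u = 0 := by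
  rw [negSubspace_eq, Submodule.orthogonal_closure, Submodule.mem_orthogonal]
  constructor
  · intro h
    have h1 := h _ ⟨u, rfl⟩
    change inner ℂ (sqrtNeg A (sqrtNeg A u)) u = 0 at h1
    rwa [inner_sqrtNeg_left, inner_self_eq_zero] at h1
  · rintro h _ ⟨v, rfl⟩
    change inner ℂ (sqrtNeg A (sqrtNeg A v)) u = 0
    rw [inner_sqrtNeg_left, h, inner_zero_right]

theorem reApplyInnerSelf_neg_of_mem (hA : IsSelfAdjoint A) {u : E} (hu : u ∈ negSubspace A)
    (h0 : u ≠ 0) : A.reApplyInnerSelf u < 0 := by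
  rw [reApplyInnerSelf_eq hA, sqrtPos_eq_zero_of_mem hu]
  have : sqrtNeg A u ≠ 0 := fun h => h0 <| by
    have := Submodule.inf_orthogonal_eq_bot (negSubspace A)
    exact (Submodule.mem_bot ℂ).1 (this ▸ ⟨hu, mem_orthogonal_negSubspace_iff.2 h⟩)
  have := norm_pos_iff.2 this
  rw [norm_zero]
  nlinarith

theorem reApplyInnerSelf_nonneg_of_mem (hA : IsSelfAdjoint A) {u : E}
    (hu : u ∈ (negSubspace A)ᗮ) : 0 ≤ A.reApplyInnerSelf u := by
  rw [reApplyInnerSelf_eq hA, mem_orthogonal_negSubspace_iff.1 hu]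
  simp

theorem apply_mem_negSubspace (hA : IsSelfAdjoint A) {u : E} (hu : u ∈ negSubspace A) :
    A u ∈ negSubspace A := by
  rw [negSubspace_eq] at hu ⊢
  have hle : (sqrtNeg A * sqrtNeg A).range.topologicalClosure ≤
      (sqrtNeg A * sqrtNeg A).range.topologicalClosure.comap (A : E →ₗ[ℂ] E) := by
    refine Submodule.topologicalClosure_minimal _ ?_
      ((Submodule.isClosed_topologicalClosure _).preimage A.continuous)
    rintro _ ⟨v, rfl⟩
    refine Submodule.le_topologicalClosure _ ⟨A v, ?_⟩
    change sqrtNeg A (sqrtNeg A (A v)) = A (sqrtNeg A (sqrtNeg A v))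
    rw [sqrtNeg_commute hA, sqrtNeg_commute hA]
  exact hle hu

theorem apply_mem_orthogonal_negSubspace (hA : IsSelfAdjoint A) {u : E}
    (hu : u ∈ (negSubspace A)ᗮ) : A u ∈ (negSubspace A)ᗮ := by
  rw [mem_orthogonal_negSubspace_iff] at hu ⊢
  rw [sqrtNeg_commute hA, hu, map_zero]

/-- An eigenvector with a negative eigenvalue lies in the negative spectral subspace: its component
orthogonal to that subspace satisfies the same equation, but the form is nonnegative there. -/
theorem mem_negSubspace_of_eigen (hA : IsSelfAdjoint A) {z : ℝ} (hz : z < 0) {u : E}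
    (hu : A u = (z : ℂ) • u) : u ∈ negSubspace A := by
  set p := (negSubspace A).starProjection u
  have hp : p ∈ negSubspace A := Submodule.starProjection_apply_mem _ _
  have hq : u - p ∈ (negSubspace A)ᗮ := Submodule.sub_starProjection_mem_orthogonal _
  have h1 : A (u - p) - (z : ℂ) • (u - p) ∈ (negSubspace A)ᗮ :=
    Submodule.sub_mem _ (apply_mem_orthogonal_negSubspace hA hq) (Submodule.smul_mem _ _ hq)
  have h2 : A (u - p) - (z : ℂ) • (u - p) ∈ negSubspace A := by
    have : A (u - p) - (z : ℂ) • (u - p) = (z : ℂ) • p - A p := by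
      rw [map_sub, hu, smul_sub]
      abel
    rw [this]
    exact Submodule.sub_mem _ (Submodule.smul_mem _ _ hp) (apply_mem_negSubspace hA hp)
  have h3 : A (u - p) = (z : ℂ) • (u - p) := by
    have := Submodule.inf_orthogonal_eq_bot (negSubspace A)
    exact sub_eq_zero.1 ((Submodule.mem_bot ℂ).1 (this ▸ ⟨h2, h1⟩))
  have h4 := reApplyInnerSelf_nonneg_of_mem hA hq
  rw [reApplyInnerSelf_of_eigen h3] at h4
  have h6 : u - p = 0 := by
    by_contra h
    have := norm_pos_iff.2 h
    have : 0 < ‖u - p‖ ^ 2 := by positivity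
    nlinarith
  rw [sub_eq_zero.1 h6]
  exact hp

/-- The spectral subspace for `(-∞, 0)` injects into `ℂ^k` by the map that certifies `k` as an upper
bound, and the `k`-dimensional negative subspace injects into it by orthogonal projection. -/
theorem HasNegIndex.finrank_negSubspace (hA : IsSelfAdjoint A) {k : ℕ} (h : HasNegIndex A k) :
    FiniteDimensional ℂ (negSubspace A) ∧ Module.finrank ℂ (negSubspace A) = k := by
  obtain ⟨⟨e, he⟩, l, hl⟩ := h
  have inj1 : Function.Injective (l ∘ₗ (negSubspace A).subtype) := by
    rw [← LinearMap.ker_eq_bot, LinearMap.ker_eq_bot']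
    intro u hu
    by_contra h0
    have h1 := reApplyInnerSelf_neg_of_mem hA u.2 (by simpa using h0)
    exact absurd (hl _ hu) (not_le.2 h1)
  have fin : FiniteDimensional ℂ (negSubspace A) := FiniteDimensional.of_injective _ inj1
  refine ⟨fin, le_antisymm ?_ ?_⟩
  · simpa using LinearMap.finrank_le_finrank_of_injective inj1
  · have inj2 : Function.Injective
        (((negSubspace A).orthogonalProjectionOnto : E →ₗ[ℂ] negSubspace A) ∘ₗ e) := by
      rw [← LinearMap.ker_eq_bot, LinearMap.ker_eq_bot']
      intro x hx
      by_contra h0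
      have h1 := (Submodule.orthogonalProjectionOnto_eq_zero_iff (K := negSubspace A)).1 hx
      exact absurd (reApplyInnerSelf_nonneg_of_mem hA h1) (not_le.2 (he x h0))
    simpa using LinearMap.finrank_le_finrank_of_injective inj2

theorem HasNegIndex.traceSpectralProj_eq (hA : IsSelfAdjoint A) {k : ℕ} (h : HasNegIndex A k) :
    traceSpectralProj A (fun x => max (0 - x) 0) = k := by
  obtain ⟨fin, hk⟩ := h.finrank_negSubspace hA
  change Cardinal.toENat (Module.rank ℂ (negSubspace A)) = k
  rw [← Module.finrank_eq_rank, hk, Cardinal.toENat_nat]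

/-- If eigenvectors are determined by their eigenvalue up to a factor, diagonalizing `A` on its
negative spectral subspace yields as many distinct negative eigenvalues as that space has
dimensions. -/
theorem HasNegIndex.encard_eigenvalues (hA : IsSelfAdjoint A) {k : ℕ} (h : HasNegIndex A k)
    (simple : ∀ (z : ℝ) (u v : E), A u = (z : ℂ) • u → A v = (z : ℂ) • v → u ≠ 0 →
      ∃ c : ℂ, v = c • u) :
    {z : ℝ | z < 0 ∧ Module.End.HasEigenvalue (A : Module.End ℂ E) (z : ℂ)}.encard = k := by
  obtain ⟨fin, hk⟩ := h.finrank_negSubspace hA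
  set T : negSubspace A →ₗ[ℂ] negSubspace A :=
    (A : E →ₗ[ℂ] E).restrict fun u hu => apply_mem_negSubspace hA hu
  have hT : T.IsSymmetric := hA.isSymmetric.restrict_invariant _
  set b := hT.eigenvectorBasis hk
  set ev := hT.eigenvalues hk
  have hb (i) : A (b i : E) = (ev i : ℂ) • (b i : E) :=
    congrArg Subtype.val (hT.apply_eigenvectorBasis hk i)
  have hb0 (i) : (b i : E) ≠ 0 := fun h => by
    have := b.orthonormal.ne_zero i
    exact this (Subtype.ext h)
  have inj : Function.Injective ev := by
    intro i j hij
    by_contra hne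
    obtain ⟨c, hc⟩ := simple (ev i) _ _ (hb i) (hij ▸ hb j) (hb0 i)
    have h1 : inner ℂ (b i : E) (b j : E) = 0 := b.orthonormal.2 hne
    rw [hc, inner_smul_right] at h1
    have hc0 : c ≠ 0 := by
      rintro rfl
      exact hb0 j (by simpa using hc)
    exact hb0 i (inner_self_eq_zero.1 ((mul_eq_zero.1 h1).resolve_left hc0))
  have hset : {z : ℝ | z < 0 ∧ Module.End.HasEigenvalue (A : Module.End ℂ E) (z : ℂ)} =
      Set.range ev := by
    ext z
    constructor
    · rintro ⟨hz, hev⟩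
      obtain ⟨u, hu⟩ := hev.exists_hasEigenvector
      have hAu : A u = (z : ℂ) • u := hu.apply_eq_smul
      have hmem := mem_negSubspace_of_eigen hA hz hAu
      have hTz : Module.End.HasEigenvalue T (z : ℂ) := by
        refine Module.End.hasEigenvalue_of_hasEigenvector (x := ⟨u, hmem⟩) ⟨?_, ?_⟩
        · rw [Module.End.mem_eigenspace_iff]
          exact Subtype.ext hAu
        · exact fun h => hu.2 (congrArg Subtype.val h)
      obtain ⟨i, hi⟩ := hT.exists_eigenvalues_eq hk hTz
      exact ⟨i, Complex.ofReal_injective hi⟩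
    · rintro ⟨i, rfl⟩
      refine ⟨?_, Module.End.hasEigenvalue_of_hasEigenvector (x := (b i : E))
        ⟨Module.End.mem_eigenspace_iff.2 (hb i), hb0 i⟩⟩
      have h1 := reApplyInnerSelf_neg_of_mem hA (b i).2 (hb0 i)
      rw [reApplyInnerSelf_of_eigen (hb i)] at h1
      have := sq_nonneg ‖(b i : E)‖
      by_contra h
      nlinarith
  rw [hset, ← Set.image_univ, inj.encard_image, Set.encard_univ, ENat.card_eq_coe_fintype_card,
    Fintype.card_fin]

/-- The reflection `4 - A` exchanges the parts of the spectrum below `0` and above `4`. -/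
theorem traceSpectralProj_four_sub (hA : IsSelfAdjoint A) :
    traceSpectralProj (algebraMap ℝ (E →L[ℂ] E) 4 - A) (fun x => max (0 - x) 0) =
      traceSpectralProj A fun x => max (x - 4) 0 := by
  have h1 : cfc (fun x : ℝ => 4 - x) A = algebraMap ℝ (E →L[ℂ] E) 4 - A := by
    rw [cfc_sub _ _ A (by fun_prop) (by fun_prop), cfc_const 4 A, cfc_id' ℝ A]
  have h2 : cfc (fun x : ℝ => max (0 - x) 0) (algebraMap ℝ (E →L[ℂ] E) 4 - A) =
      cfc (fun x : ℝ => max (x - 4) 0) A := by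
    rw [← h1, ← cfc_comp' (fun x : ℝ => max (0 - x) 0) (fun x : ℝ => 4 - x) A (by fun_prop)
      (by fun_prop)]
    congr 1
    ext x
    congr 1
    ring
  rw [traceSpectralProj, traceSpectralProj, h2]

theorem isSelfAdjoint_four_sub (hA : IsSelfAdjoint A) :
    IsSelfAdjoint (algebraMap ℝ (E →L[ℂ] E) 4 - A) :=
  ((IsSelfAdjoint.all (4 : ℝ)).algebraMap _).sub hA

end NegIndex

/-! ### The threshold solution and its sign changes -/

/-- The polynomials `Q_n`, evaluated along an infinite sequence of parameters. Up to the factor `√2`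
at the first site, this is the solution of `H u = 0` regarded as a recurrence. -/
def qSeq (a : ℕ → ℝ) : ℕ → ℝ
  | 0 => 1
  | 1 => 1 + a 0
  | n + 2 => (2 + a (n + 1)) * qSeq a (n + 1) - qSeq a n

/-- The number of sign changes in `qSeq a 0, …, qSeq a n`, meant for `qSeq a n ≠ 0`. A zero
lies between two nonzero terms of opposite signs; that change is counted at the zero. -/
def changes (a : ℕ → ℝ) : ℕ → ℕ
  | 0 => 0
  | n + 1 => changes a n + if qSeq a n * qSeq a (n + 1) < 0 ∨ qSeq a n = 0 then 1 else 0

theorem qSeq_congr {a b : ℕ → ℝ} : ∀ {n : ℕ}, (∀ m < n, a m = b m) → qSeq a n = qSeq b n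
  | 0, _ => rfl
  | 1, h => by simp [qSeq, h 0]
  | n + 2, h => by
    simp only [qSeq]
    rw [h (n + 1) (by omega), qSeq_congr (n := n + 1) fun m hm => h m (by omega),
      qSeq_congr (n := n) fun m hm => h m (by omega)]

theorem changes_congr {a b : ℕ → ℝ} : ∀ {n : ℕ}, (∀ m < n, a m = b m) → changes a n = changes b n
  | 0, _ => rfl
  | n + 1, h => by
    simp only [changes]
    rw [qSeq_congr h, qSeq_congr (n := n) fun m hm => h m (by omega),
      changes_congr (n := n) fun m hm => h m (by omega)]

theorem qSeq_ne_zero_or (a : ℕ → ℝ) : ∀ n, qSeq a n ≠ 0 ∨ qSeq a (n + 1) ≠ 0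
  | 0 => Or.inl one_ne_zero
  | n + 1 => by
    by_contra! h
    have h2 : qSeq a n = 0 := by
      have := h.2
      simp only [qSeq, h.1] at this
      linarith
    exact (qSeq_ne_zero_or a n).elim (fun h3 => h3 h2) fun h3 => h3 h.1

theorem qSeq_of_eq_zero {a : ℕ → ℝ} {n : ℕ} (h : qSeq a (n + 1) = 0) :
    qSeq a (n + 2) = -qSeq a n := by
  simp [qSeq, h]

/-- Induction along the nonzero values of `qSeq a`: no two consecutive values vanish, so isolated
zeros are skipped. -/
theorem qSeq_induction (a : ℕ → ℝ) {motive : ℕ → Prop} (zero : motive 0)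
    (step : ∀ n, qSeq a n ≠ 0 → qSeq a (n + 1) ≠ 0 → motive n → motive (n + 1))
    (skip : ∀ n, qSeq a n ≠ 0 → qSeq a (n + 1) = 0 → motive n → motive (n + 2)) :
    ∀ n, qSeq a n ≠ 0 → motive n
  | 0, _ => zero
  | 1, h => step 0 one_ne_zero h zero
  | n + 2, h => by
    by_cases h1 : qSeq a (n + 1) = 0
    · have h0 := (qSeq_ne_zero_or a n).resolve_right (not_not.2 h1)
      exact skip n h0 h1 (qSeq_induction a zero step skip n h0)
    · exact step (n + 1) h1 h (qSeq_induction a zero step skip (n + 1) h1)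

theorem changes_succ_of_pos {a : ℕ → ℝ} {n : ℕ} (h : 0 < qSeq a n * qSeq a (n + 1)) :
    changes a (n + 1) = changes a n := by
  have h0 : qSeq a n ≠ 0 := left_ne_zero_of_mul h.ne'
  simp [changes, h0, h.le]

theorem changes_succ_of_neg {a : ℕ → ℝ} {n : ℕ} (h : qSeq a n * qSeq a (n + 1) < 0) :
    changes a (n + 1) = changes a n + 1 := by
  simp [changes, h]

/-- Between two values of opposite signs there is exactly one change, whatever the sign of the value
in the middle, zero included. -/
theorem changes_add_two_of_neg {a : ℕ → ℝ} {n : ℕ} (h : qSeq a n * qSeq a (n + 2) < 0) :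
    changes a (n + 2) = changes a n + 1 := by
  simp only [changes, add_assoc]
  congr 1
  have h0 : qSeq a n ≠ 0 := left_ne_zero_of_mul h.ne
  rcases lt_trichotomy (qSeq a (n + 1)) 0 with h1 | h1 | h1 <;>
    rcases lt_or_gt_of_ne h0 with h2 | h2
  · have h3 : 0 < qSeq a (n + 2) := by nlinarith
    rw [if_neg, if_pos]
    · exact Or.inl (mul_neg_of_neg_of_pos h1 h3)
    · simp [h0, (mul_pos_of_neg_of_neg h2 h1).le]
  · have h3 : qSeq a (n + 2) < 0 := by nlinarith
    rw [if_pos, if_neg]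
    · simp [h1.ne, (mul_pos_of_neg_of_neg h1 h3).le]
    · exact Or.inl (mul_neg_of_pos_of_neg h2 h1)
  · simp [h1, h0]
  · simp [h1, h0]
  · have h3 : 0 < qSeq a (n + 2) := by nlinarith
    rw [if_pos, if_neg]
    · simp [h1.ne', (mul_pos h1 h3).le]
    · exact Or.inl (mul_neg_of_neg_of_pos h2 h1)
  · have h3 : qSeq a (n + 2) < 0 := by nlinarith
    rw [if_neg, if_pos]
    · exact Or.inl (mul_neg_of_pos_of_neg h1 h3)
    · simp [h0, (mul_pos h2 h1).le]

theorem continuous_qSeq : ∀ n, Continuous fun a : ℕ → ℝ => qSeq a n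
  | 0 => continuous_const
  | 1 => by
    simp only [qSeq]
    fun_prop
  | n + 2 => by
    have h1 := continuous_qSeq (n + 1)
    have h2 := continuous_qSeq n
    simp only [qSeq]
    fun_prop

open Filter Topology in
/-- When an intermediate value passes through zero, the single sign change around it only moves to a
neighbouring site. -/
theorem changes_eventually_eq {a : ℕ → ℝ} {n : ℕ} (h : qSeq a n ≠ 0) :
    ∀ᶠ b in 𝓝 a, changes b n = changes a n := by
  refine qSeq_induction a (motive := fun n => ∀ᶠ b in 𝓝 a, changes b n = changes a n)
    (Eventually.of_forall fun _ => rfl) (fun n h0 h1 ih => ?_) (fun n h0 h1 ih => ?_) n h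
  · have hc := ((continuous_qSeq n).mul (continuous_qSeq (n + 1))).continuousAt (x := a)
    rcases lt_or_gt_of_ne (mul_ne_zero h0 h1) with h2 | h2
    · filter_upwards [ih, hc.eventually_lt continuousAt_const h2] with b hb hb2
      rw [changes_succ_of_neg h2, changes_succ_of_neg hb2, hb]
    · filter_upwards [ih, continuousAt_const.eventually_lt hc h2] with b hb hb2
      rw [changes_succ_of_pos h2, changes_succ_of_pos hb2, hb]
  · have hc := ((continuous_qSeq n).mul (continuous_qSeq (n + 2))).continuousAt (x := a)
    have h2 : qSeq a n * qSeq a (n + 2) < 0 := by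
      rw [qSeq_of_eq_zero h1]
      have := mul_self_pos.2 h0
      linarith
    filter_upwards [ih, hc.eventually_lt continuousAt_const h2] with b hb hb2
    rw [changes_add_two_of_neg h2, changes_add_two_of_neg hb2, hb]

/-- Beyond the support of the parameters the solution is affine. -/
theorem qSeq_add {a : ℕ → ℝ} {p : ℕ} (ha : ∀ m, p < m → a m = 0) :
    ∀ j : ℕ, qSeq a (p + j) = qSeq a p + j * (qSeq a (p + 1) - qSeq a p)
  | 0 => by simp
  | 1 => by simp
  | j + 2 => by
    have h1 := qSeq_add ha (j + 1)
    have h2 := qSeq_add ha j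
    have h3 : qSeq a (p + (j + 2)) =
        (2 + a (p + j + 1)) * qSeq a (p + j + 1) - qSeq a (p + j) := rfl
    rw [h3, ha _ (by omega), h2, add_assoc p j 1, h1]
    push_cast
    ring

/-- The number of sign changes in `qSeq a 0, …, qSeq a p`, followed by the slope
`qSeq a (p + 1) - qSeq a p` of the solution at infinity, meant for nonzero slope. -/
def slopeIndex (a : ℕ → ℝ) (p : ℕ) : ℕ :=
  changes a p + if (qSeq a (p + 1) - qSeq a p) * qSeq a p ≤ 0 then 1 else 0

/-- Far beyond the support the affine solution has the sign of its slope, and it changes sign at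
most once on the way. -/
theorem exists_changes_eq_slopeIndex {a : ℕ → ℝ} {p : ℕ} (ha : ∀ m, p < m → a m = 0)
    (hs : qSeq a (p + 1) - qSeq a p ≠ 0) :
    ∃ N, p < N ∧ qSeq a N ≠ 0 ∧ changes a N = slopeIndex a p := by
  set s := qSeq a (p + 1) - qSeq a p
  have hs2 : 0 < s * s := mul_self_pos.2 hs
  have hstep (j : ℕ) : s * qSeq a (p + j + 1) = s * qSeq a (p + j) + s * s := by
    rw [add_assoc, qSeq_add ha (j + 1), qSeq_add ha j]
    push_cast
    ring
  -- The extra change happens at the step where `s * qSeq a (p + j)` becomes positive, if it was not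
  -- positive at `j = 0`.
  have key (j : ℕ) : (0 < s * qSeq a p → 0 < s * qSeq a (p + j)) ∧
      changes a (p + j) =
        changes a p + if s * qSeq a p ≤ 0 ∧ 0 < s * qSeq a (p + j) then 1 else 0 := by
    induction j with
    | zero =>
      refine ⟨id, ?_⟩
      rw [if_neg]
      · rfl
      · rintro ⟨h1, h2⟩
        exact absurd h2 (not_lt.2 h1)
    | succ j ih =>
      have h1 := hstep j
      have hprod : (s * qSeq a (p + j)) * (s * qSeq a (p + j + 1)) =
          (s * s) * (qSeq a (p + j) * qSeq a (p + j + 1)) := by ring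
      refine ⟨fun h => ?_, ?_⟩
      · have := ih.1 h
        rw [← add_assoc, h1]
        linarith
      · rw [← add_assoc]
        by_cases h2 : 0 < s * qSeq a (p + j)
        · have h3 : 0 < s * qSeq a (p + j + 1) := by linarith
          have h4 := mul_pos h2 h3
          rw [hprod] at h4
          rw [changes_succ_of_pos (pos_of_mul_pos_right h4 hs2.le), ih.2]
          simp [h2, h3]
        · have h5 : s * qSeq a p ≤ 0 := by
            by_contra! h
            exact h2 (ih.1 h)
          rw [changes, ih.2]
          have : (qSeq a (p + j) * qSeq a (p + j + 1) < 0 ∨ qSeq a (p + j) = 0) ↔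
              0 < s * qSeq a (p + j + 1) := by
            constructor
            · rintro (h | h)
              · by_contra! h6
                have := mul_nonneg_of_nonpos_of_nonpos (not_lt.1 h2) h6
                rw [hprod] at this
                nlinarith
              · rw [h1, h]
                simpa using hs2
            · intro h
              rcases (not_lt.1 h2).lt_or_eq with h6 | h6
              · left
                have := mul_neg_of_neg_of_pos h6 h
                rw [hprod] at this
                by_contra! h7
                nlinarith
              · exact Or.inr ((mul_eq_zero.1 h6).resolve_left hs)
          simp only [this, h2, h5, and_false, true_and, if_false]
          rfl
  obtain ⟨j, hj⟩ := exists_nat_gt (-(s * qSeq a p) / (s * s))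
  rw [div_lt_iff₀ hs2] at hj
  have hpos : 0 < s * qSeq a (p + (j + 1)) := by
    rw [qSeq_add ha]
    push_cast
    change 0 < s * (qSeq a p + (j + 1) * s)
    linarith
  refine ⟨p + (j + 1), by omega, right_ne_zero_of_mul hpos.ne', ?_⟩
  rw [(key (j + 1)).2, slopeIndex]
  simp [hpos, s]

/-! ### Tridiagonal hermitian forms -/

open Complex

/-- The hermitian form on `ℂ^n` with diagonal `1 + a 0, 2 + a 1, …, 2 + a (n - 1)` and off-diagonal
entries `-1`, whose leading minors are `qSeq a 1, …, qSeq a n`; it is evaluated on sequences, of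
which it sees the first `n` entries. -/
def triForm (a : ℕ → ℝ) : ℕ → (ℕ → ℂ) → ℝ
  | 0, _ => 0
  | 1, w => (1 + a 0) * normSq (w 0)
  | n + 2, w => triForm a (n + 1) w + (2 + a (n + 1)) * normSq (w (n + 1)) -
      2 * (starRingEnd ℂ (w n) * w (n + 1)).re

theorem triForm_congr {a : ℕ → ℝ} {v w : ℕ → ℂ} :
    ∀ {n : ℕ}, (∀ m < n, v m = w m) → triForm a n v = triForm a n w
  | 0, _ => rfl
  | 1, h => by simp [triForm, h 0]
  | n + 2, h => by
    simp only [triForm]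
    rw [h (n + 1) (by omega), h n (by omega),
      triForm_congr (n := n + 1) fun m hm => h m (by omega)]

theorem triForm_congr_left {a b : ℕ → ℝ} {w : ℕ → ℂ} :
    ∀ {n : ℕ}, (∀ m < n, a m = b m) → triForm a n w = triForm b n w
  | 0, _ => rfl
  | 1, h => by simp [triForm, h 0]
  | n + 2, h => by
    simp only [triForm]
    rw [h (n + 1) (by omega), triForm_congr_left (n := n + 1) fun m hm => h m (by omega)]

theorem triForm_succ_of_eq_zero {a : ℕ → ℝ} {w : ℕ → ℂ} :
    ∀ {n : ℕ}, w n = 0 → triForm a (n + 1) w = triForm a n w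
  | 0, h => by simp [triForm, h]
  | n + 1, h => by simp [triForm, h]

theorem triForm_zero_right (a : ℕ → ℝ) : ∀ n, triForm a n 0 = 0
  | 0 => rfl
  | 1 => by simp [triForm]
  | n + 2 => by simp [triForm, triForm_zero_right a (n + 1)]

/-- The sequence `qSeq a`, as a complex sequence. -/
def qVec (a : ℕ → ℝ) : ℕ → ℂ := fun m => (qSeq a m : ℂ)

/-- `qSeq a` solves the tridiagonal system with right-hand side supported at the last site. -/
theorem triForm_add_smul_qVec (a : ℕ → ℝ) (w : ℕ → ℂ) (t : ℂ) : ∀ n : ℕ,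
    triForm a (n + 1) (w + t • qVec a) = triForm a (n + 1) w +
      2 * qSeq a (n + 1) * (starRingEnd ℂ t * w n).re + normSq t * (qSeq a n * qSeq a (n + 1))
  | 0 => by
    simp [triForm, qVec, qSeq, normSq_apply]
    ring
  | n + 1 => by
    have h := triForm_add_smul_qVec a w t n
    have h2 : qSeq a (n + 2) = (2 + a (n + 1)) * qSeq a (n + 1) - qSeq a n := rfl
    rw [h2, triForm, h, triForm]
    simp [qVec, normSq_apply]
    ring

/-- The shear that eliminates the coordinate `n` from the first `n` coordinates. -/
def shear (a : ℕ → ℝ) (n : ℕ) : (ℕ → ℂ) →ₗ[ℂ] (ℕ → ℂ) :=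
  LinearMap.id - (LinearMap.proj n : (ℕ → ℂ) →ₗ[ℂ] ℂ).smulRight ((qSeq a n : ℂ)⁻¹ • qVec a)

theorem shear_apply (a : ℕ → ℝ) (n : ℕ) (w : ℕ → ℂ) :
    shear a n w = w - (w n * (qSeq a n : ℂ)⁻¹) • qVec a := by
  simp [shear, smul_smul]

/-- Completing the square: the pivots of the form are the ratios of its leading minors. -/
theorem triForm_succ_eq {a : ℕ → ℝ} (w : ℕ → ℂ) : ∀ {n : ℕ}, qSeq a n ≠ 0 →
    triForm a (n + 1) w =
      triForm a n (shear a n w) + qSeq a (n + 1) / qSeq a n * normSq (w n)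
  | 0, _ => by simp [triForm, qSeq]
  | n + 1, h => by
    have hC : (qSeq a (n + 1) : ℂ) ≠ 0 := by exact_mod_cast h
    set t := w (n + 1) * (qSeq a (n + 1) : ℂ)⁻¹ with ht
    have hw : w (n + 1) = t * qSeq a (n + 1) := by
      rw [ht]
      field_simp
    have h1 := triForm_add_smul_qVec a (shear a (n + 1) w) t n
    have h2 : shear a (n + 1) w + t • qVec a = w := by
      rw [shear_apply]
      simp [ht]
    have h3 : shear a (n + 1) w n = w n - t * qSeq a n := by
      rw [shear_apply]
      simp [qVec, ht]
    rw [h2, h3] at h1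
    rw [triForm, h1, hw, qSeq]
    field_simp
    simp [normSq_apply]
    ring

/-- The first half of the computation of the negative index: `triForm a n` is negative definite on
a `k`-dimensional space of sequences supported on the first `n` sites. -/
def HasNegDim (a : ℕ → ℝ) (n k : ℕ) : Prop :=
  ∃ e : (Fin k → ℂ) →ₗ[ℂ] (ℕ → ℂ), (∀ x m, n ≤ m → e x m = 0) ∧
    ∀ x, x ≠ 0 → triForm a n (e x) < 0

/-- The second half of the computation of the negative index: `triForm a n` is nonnegative on a
space of codimension at most `k`. -/
def HasNonnegCodim (a : ℕ → ℝ) (n k : ℕ) : Prop :=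
  ∃ l : (ℕ → ℂ) →ₗ[ℂ] (Fin k → ℂ), ∀ w, l w = 0 → 0 ≤ triForm a n w

/-- One more negative direction `v`, orthogonal to the given negative subspace for the form. -/
theorem HasNegDim.extend {a : ℕ → ℝ} {n N k : ℕ} (h : HasNegDim a n k) (hN : n ≤ N) (v : ℕ → ℂ)
    (hv : ∀ m, N ≤ m → v m = 0) {c : ℝ} (hc : c < 0)
    (hform : ∀ (w : ℕ → ℂ) (t : ℂ), (∀ m, n ≤ m → w m = 0) →
      triForm a N (w + t • v) = triForm a n w + c * normSq t) :
    HasNegDim a N (k + 1) := by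
  obtain ⟨e, he, hneg⟩ := h
  refine ⟨e ∘ₗ LinearMap.funLeft ℂ ℂ Fin.castSucc + (LinearMap.proj (Fin.last k)).smulRight v,
    fun x m hm => ?_, fun x hx => ?_⟩
  · simp [he _ m (hN.trans hm), hv m hm]
  · rw [LinearMap.add_apply, LinearMap.smulRight_apply, LinearMap.comp_apply,
      hform _ _ (he _), LinearMap.proj_apply]
    by_cases h0 : LinearMap.funLeft ℂ ℂ Fin.castSucc x = 0
    · have hlast : x (Fin.last k) ≠ 0 := fun hl => hx <| by
        ext i
        refine Fin.lastCases hl (fun j => ?_) i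
        exact congrFun h0 j
      have := normSq_pos.2 hlast
      rw [h0, map_zero, triForm_zero_right]
      nlinarith
    · have := normSq_nonneg (x (Fin.last k))
      have := hneg _ h0
      nlinarith

theorem HasNonnegCodim.mono {a : ℕ → ℝ} {n N k : ℕ} (h : HasNonnegCodim a n k)
    (s : (ℕ → ℂ) →ₗ[ℂ] (ℕ → ℂ)) (hs : ∀ w, triForm a n (s w) ≤ triForm a N w) :
    HasNonnegCodim a N k := by
  obtain ⟨l, hl⟩ := h
  exact ⟨l ∘ₗ s, fun w hw => (hl _ hw).trans (hs w)⟩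

theorem HasNonnegCodim.extend {a : ℕ → ℝ} {n N k : ℕ} (h : HasNonnegCodim a n k)
    (s : (ℕ → ℂ) →ₗ[ℂ] (ℕ → ℂ)) (f : (ℕ → ℂ) →ₗ[ℂ] ℂ)
    (hs : ∀ w, f w = 0 → triForm a n (s w) ≤ triForm a N w) : HasNonnegCodim a N (k + 1) := by
  obtain ⟨l, hl⟩ := h
  refine ⟨LinearMap.pi (Fin.lastCases f fun i => LinearMap.proj i ∘ₗ l ∘ₗ s), fun w hw => ?_⟩
  have h1 : f w = 0 := by simpa using congrFun hw (Fin.last k)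
  refine (hl (s w) ?_).trans (hs w h1)
  ext i
  simpa using congrFun hw i.castSucc

/-- The vector that completes a square at the site `n`, cut off there and continued by `c` at the
site `n + 1`. -/
def pivotVec (a : ℕ → ℝ) (n : ℕ) (c : ℂ) : ℕ → ℂ :=
  fun m => if m ≤ n then qVec a m else if m = n + 1 then c else 0

/-- Up to the site `n` the vector `qVec a` is orthogonal for the form to all sequences supported on
the sites before `n`. -/
theorem triForm_pivotVec {a : ℕ → ℝ} {n : ℕ} (hq : qSeq a n ≠ 0) {w : ℕ → ℂ}
    (hw : w n = 0) (c t : ℂ) :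
    triForm a (n + 1) (w + t • pivotVec a n c) =
      triForm a n w + qSeq a n * qSeq a (n + 1) * normSq t := by
  have hC : (qSeq a n : ℂ) ≠ 0 := by exact_mod_cast hq
  rw [triForm_succ_eq _ hq]
  have hn : (w + t • pivotVec a n c) n = t * qSeq a n := by simp [hw, pivotVec, qVec]
  rw [hn]
  congr 1
  · refine triForm_congr fun m hm => ?_
    rw [shear_apply, hn, mul_assoc, mul_inv_cancel₀ hC]
    simp [pivotVec, hm.le]
  · rw [map_mul, normSq_ofReal]
    field_simp

theorem hasNegDim_changes {a : ℕ → ℝ} {n : ℕ} (h : qSeq a n ≠ 0) :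
    HasNegDim a n (changes a n) := by
  refine qSeq_induction a (motive := fun n => HasNegDim a n (changes a n)) ?_
    (fun n h0 h1 ih => ?_) (fun n h0 h1 ih => ?_) n h
  · exact ⟨0, fun _ _ _ => rfl, fun x hx => (hx (Subsingleton.elim (α := Fin 0 → ℂ) x 0)).elim⟩
  · rcases lt_or_gt_of_ne (mul_ne_zero h0 h1) with h2 | h2
    · rw [changes_succ_of_neg h2]
      refine ih.extend n.le_succ (pivotVec a n 0) (fun m hm => ?_) h2 fun w t hw =>
        triForm_pivotVec h0 (hw n le_rfl) 0 t
      simp [pivotVec, show ¬ m ≤ n by omega]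
    · rw [changes_succ_of_pos h2]
      obtain ⟨e, he, hneg⟩ := ih
      refine ⟨e, fun x m hm => he x m (by omega), fun x hx => ?_⟩
      rw [triForm_succ_of_eq_zero (he x n le_rfl)]
      exact hneg x hx
  · have h2 : qSeq a n * qSeq a (n + 2) < 0 := by
      rw [qSeq_of_eq_zero h1]
      have := mul_self_pos.2 h0
      linarith
    rw [changes_add_two_of_neg h2]
    -- On the hyperbolic plane `(2 + a) |t|² - 2 Re (s̄ t)` the vector `(1, r)` is negative for
    -- small `r > 0`.
    set r : ℝ := 1 / (1 + |2 + a (n + 1)|) with hr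
    have hpos : 0 < 1 + |2 + a (n + 1)| := by positivity
    have hr0 : 0 < r := by positivity
    have hr1 : r * |2 + a (n + 1)| ≤ 1 := by
      rw [hr, one_div, inv_mul_le_iff₀ hpos]
      linarith
    have hc : qSeq a n ^ 2 * (r * (r * (2 + a (n + 1)) - 2)) < 0 := by
      refine mul_neg_of_pos_of_neg (by positivity) (mul_neg_of_pos_of_neg hr0 ?_)
      have := mul_le_mul_of_nonneg_left (le_abs_self (2 + a (n + 1))) hr0.le
      linarith
    refine ih.extend (N := n + 2) (by omega) (pivotVec a n (r * qSeq a n)) (fun m hm => ?_) hc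
      fun w t hw => ?_
    · simp [pivotVec, show ¬ m ≤ n by omega, show m ≠ n + 1 by omega]
    · rw [triForm, triForm_pivotVec h0 (hw n le_rfl), h1]
      simp [pivotVec, qVec, hw n le_rfl, hw (n + 1) (by omega), normSq_apply]
      ring

theorem hasNonnegCodim_changes {a : ℕ → ℝ} {n : ℕ} (h : qSeq a n ≠ 0) :
    HasNonnegCodim a n (changes a n) := by
  refine qSeq_induction a (motive := fun n => HasNonnegCodim a n (changes a n)) ?_
    (fun n h0 h1 ih => ?_) (fun n h0 h1 ih => ?_) n h
  · exact ⟨0, fun _ _ => le_rfl⟩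
  · rcases lt_or_gt_of_ne (mul_ne_zero h0 h1) with h2 | h2
    · rw [changes_succ_of_neg h2]
      refine ih.extend (shear a n) (LinearMap.proj n) fun w hw => ?_
      rw [triForm_succ_eq w h0, show w n = 0 from hw]
      simp
    · rw [changes_succ_of_pos h2]
      refine ih.mono (shear a n) fun w => ?_
      rw [triForm_succ_eq w h0]
      have h3 : 0 < qSeq a (n + 1) / qSeq a n := by
        rw [← mul_div_mul_left _ _ h0]
        exact div_pos h2 (mul_self_pos.2 h0)
      have := mul_nonneg h3.le (normSq_nonneg (w n))
      linarith
  · have h2 : qSeq a n * qSeq a (n + 2) < 0 := by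
      rw [qSeq_of_eq_zero h1]
      have := mul_self_pos.2 h0
      linarith
    rw [changes_add_two_of_neg h2]
    refine ih.extend (shear a n) (LinearMap.proj (n + 1)) fun w hw => ?_
    rw [triForm, triForm_succ_eq w h0, show w (n + 1) = 0 from hw, h1]
    simp

/-! ### The form with the last bond cut -/

theorem two_mul_re_le (x y : ℂ) : 2 * (starRingEnd ℂ x * y).re ≤ normSq x + normSq y := by
  simp only [normSq_apply, mul_re, conj_re, conj_im]
  nlinarith [sq_nonneg (x.re - y.re), sq_nonneg (x.im - y.im)]

/-- The parameters shifted by `t` at the site `p`. -/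
def bump (a : ℕ → ℝ) (p : ℕ) (t : ℝ) : ℕ → ℝ := Function.update a p (a p + t)

theorem bump_of_lt {a : ℕ → ℝ} {p m : ℕ} (t : ℝ) (h : m < p) : bump a p t m = a m :=
  Function.update_of_ne h.ne _ _

theorem triForm_bump (a : ℕ → ℝ) (p : ℕ) (t : ℝ) (w : ℕ → ℂ) :
    triForm (bump a p t) (p + 1) w = triForm a (p + 1) w + t * normSq (w p) := by
  cases p with
  | zero =>
    simp [triForm, bump]
    ring
  | succ p =>
    rw [triForm, triForm, triForm_congr_left (b := a) fun m hm => bump_of_lt t hm]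
    simp [bump]
    ring

theorem qSeq_bump (a : ℕ → ℝ) (p : ℕ) (t : ℝ) :
    qSeq (bump a p t) (p + 1) = qSeq a (p + 1) + t * qSeq a p := by
  cases p with
  | zero =>
    simp [qSeq, bump]
    ring
  | succ p =>
    rw [qSeq, qSeq, qSeq_congr (b := a) fun m hm => bump_of_lt t hm,
      qSeq_congr (n := p) (b := a) fun m hm => bump_of_lt t (by omega)]
    simp [bump]
    ring

theorem qSeq_bump_self (a : ℕ → ℝ) (p : ℕ) (t : ℝ) : qSeq (bump a p t) p = qSeq a p :=
  qSeq_congr fun _ hm => bump_of_lt t hm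

theorem changes_bump_self (a : ℕ → ℝ) (p : ℕ) (t : ℝ) : changes (bump a p t) p = changes a p :=
  changes_congr fun _ hm => bump_of_lt t hm

/-- Shifting the last parameter by `-1` replaces the last value of `qSeq a` by the slope at
infinity. -/
theorem qSeq_bump_neg_one (a : ℕ → ℝ) (p : ℕ) :
    qSeq (bump a p (-1)) (p + 1) = qSeq a (p + 1) - qSeq a p := by
  rw [qSeq_bump]
  ring

theorem changes_bump_neg_one {a : ℕ → ℝ} {p : ℕ} (hs : qSeq a (p + 1) - qSeq a p ≠ 0) :
    changes (bump a p (-1)) (p + 1) = slopeIndex a p := by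
  rw [changes, slopeIndex, changes_bump_self, qSeq_bump_self, qSeq_bump_neg_one]
  congr 1
  refine if_congr ?_ rfl rfl
  rw [le_iff_lt_or_eq, mul_comm, mul_eq_zero]
  simp [hs]

/-- Cutting the bond behind the site `p` lowers the form: the remainder is a sum of squares of
differences and of the last coordinate. -/
theorem le_triForm_add {a : ℕ → ℝ} {p : ℕ} (ha : ∀ m, p < m → a m = 0) (w : ℕ → ℂ) (j : ℕ) :
    triForm (bump a p (-1)) (p + 1) w + normSq (w (p + j)) ≤ triForm a (p + j + 1) w := by
  induction j with
  | zero => simp [triForm_bump]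
  | succ j ih =>
    have h := two_mul_re_le (w (p + j)) (w (p + j + 1))
    rw [← add_assoc, triForm, ha _ (by omega)]
    linarith

theorem triForm_add_triForm_neg (a : ℕ → ℝ) (w : ℕ → ℂ) (n : ℕ) :
    2 * normSq (w n) ≤ triForm a (n + 1) w + triForm (-a) (n + 1) w := by
  induction n with
  | zero =>
    simp only [triForm, Pi.neg_apply]
    linarith
  | succ n ih =>
    have h := two_mul_re_le (w n) (w (n + 1))
    simp only [triForm, Pi.neg_apply]
    linarith

/-- Negative subspaces of two forms with nonnegative sum are independent. -/
theorem HasNegDim.add_le {a b : ℕ → ℝ} {n k l : ℕ} (ha : HasNegDim a n k) (hb : HasNegDim b n l)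
    (hab : ∀ w, 0 ≤ triForm a n w + triForm b n w) : k + l ≤ n := by
  obtain ⟨e, he, hneg⟩ := ha
  obtain ⟨f, hf, hneg'⟩ := hb
  set T : ((Fin k → ℂ) × (Fin l → ℂ)) →ₗ[ℂ] (Fin n → ℂ) :=
    LinearMap.funLeft ℂ ℂ (fun i : Fin n => (i : ℕ)) ∘ₗ (e.coprod (-f))
  have inj : Function.Injective T := by
    rw [← LinearMap.ker_eq_bot, LinearMap.ker_eq_bot']
    rintro ⟨x, y⟩ hxy
    have h1 : ∀ m < n, e x m = f y m := fun m hm => by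
      have := congrFun hxy ⟨m, hm⟩
      simpa [T, LinearMap.funLeft, ← sub_eq_add_neg, sub_eq_zero] using this
    have h2 := hab (e x)
    have h3 : triForm b n (e x) = triForm b n (f y) := triForm_congr h1
    have h4 : triForm a n (e x) ≤ 0 := by
      by_cases hx : x = 0
      · rw [hx, map_zero, triForm_zero_right]
      · exact (hneg x hx).le
    have h5 : triForm b n (f y) ≤ 0 := by
      by_cases hy : y = 0
      · rw [hy, map_zero, triForm_zero_right]
      · exact (hneg' y hy).le
    have hx : x = 0 := by
      by_contra hx
      have := hneg x hx
      linarith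
    have hy : y = 0 := by
      by_contra hy
      have := hneg' y hy
      linarith
    rw [hx, hy]
    rfl
  simpa using LinearMap.finrank_le_finrank_of_injective inj

/-- The two threshold indices add up to at most the number of sites, since the forms that they count
add up to twice the form of a nonnegative discrete Laplacian. -/
theorem slopeIndex_add_le {a : ℕ → ℝ} {p : ℕ} (hs : qSeq a (p + 1) - qSeq a p ≠ 0)
    (hs' : qSeq (-a) (p + 1) - qSeq (-a) p ≠ 0) :
    slopeIndex a p + slopeIndex (-a) p ≤ p + 1 := by
  have h1 := hasNegDim_changes (a := bump a p (-1)) (n := p + 1) (by rwa [qSeq_bump_neg_one])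
  have h2 := hasNegDim_changes (a := bump (-a) p (-1)) (n := p + 1) (by rwa [qSeq_bump_neg_one])
  rw [changes_bump_neg_one hs] at h1
  rw [changes_bump_neg_one hs'] at h2
  refine h1.add_le h2 fun w => ?_
  rw [triForm_bump, triForm_bump]
  have := triForm_add_triForm_neg a w p
  linarith

/-! ### The regions in terms of sign changes -/

theorem Q_eq_qSeq {a : ℕ → ℝ} : ∀ {n : ℕ} {μ : Fin n → ℝ}, (∀ i : Fin n, a i = μ i) →
    Q n μ = qSeq a n
  | 0, _, _ => rfl
  | 1, μ, h => by simp [Q, qSeq, ← h 0]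
  | n + 2, μ, h => by
    have h1 : Q (n + 1) (Fin.init μ) = qSeq a (n + 1) := Q_eq_qSeq fun i => h i.castSucc
    have h0 : Q n (Fin.init (Fin.init μ)) = qSeq a n := Q_eq_qSeq fun i => h i.castSucc.castSucc
    rw [Q, qSeq, h1, h0, ← h (Fin.last (n + 1))]
    rfl

theorem Phi_lt_iff {a : ℕ → ℝ} {n : ℕ} {μ : Fin (n + 1) → ℝ} (h : ∀ i : Fin (n + 1), a i = μ i)
    (hq : qSeq a (n + 1) ≠ 0) :
    Phi (n + 1) μ < a (n + 1) ↔ 0 < qSeq a (n + 1) * qSeq a (n + 2) := by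
  have h0 : Q n (Fin.init μ) = qSeq a n := Q_eq_qSeq fun i => h i.castSucc
  have hq2 : 0 < qSeq a (n + 1) * qSeq a (n + 1) := mul_self_pos.2 hq
  rw [Phi, h0, Q_eq_qSeq h, ← mul_div_mul_left _ _ hq, sub_lt_iff_lt_add, div_lt_iff₀ hq2, qSeq]
  constructor <;> intro h <;> linarith

theorem lt_Phi_iff {a : ℕ → ℝ} {n : ℕ} {μ : Fin (n + 1) → ℝ} (h : ∀ i : Fin (n + 1), a i = μ i)
    (hq : qSeq a (n + 1) ≠ 0) :
    a (n + 1) < Phi (n + 1) μ ↔ qSeq a (n + 1) * qSeq a (n + 2) < 0 := by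
  have h0 : Q n (Fin.init μ) = qSeq a n := Q_eq_qSeq fun i => h i.castSucc
  have hq2 : 0 < qSeq a (n + 1) * qSeq a (n + 1) := mul_self_pos.2 hq
  rw [Phi, h0, Q_eq_qSeq h, ← mul_div_mul_left _ _ hq, lt_sub_iff_add_lt, lt_div_iff₀ hq2, qSeq]
  constructor <;> intro h <;> linarith

theorem eq_Phi_iff {a : ℕ → ℝ} : ∀ {n : ℕ} {μ : Fin n → ℝ}, (∀ i : Fin n, a i = μ i) →
    qSeq a n ≠ 0 → (a n = Phi n μ ↔ qSeq a (n + 1) = 0)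
  | 0, _, _, _ => by
    simp only [Phi, qSeq]
    constructor <;> intro h <;> linarith
  | n + 1, μ, h, hq => by
    have h0 : Q n (Fin.init μ) = qSeq a n := Q_eq_qSeq fun i => h i.castSucc
    rw [Phi, h0, Q_eq_qSeq h, eq_sub_iff_add_eq, eq_div_iff hq, qSeq]
    constructor <;> intro h <;> linarith

/-- The region `D n k` consists of the parameters for which `Q_0, …, Q_n` ends in a nonzero value
and changes sign exactly `k` times. -/
theorem mem_D_iff {a : ℕ → ℝ} : ∀ {n k : ℕ} {μ : Fin n → ℝ}, (∀ i : Fin n, a i = μ i) →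
    (μ ∈ D n k ↔ qSeq a n ≠ 0 ∧ changes a n = k)
  | 0, 0, _, _ => by simp [D, qSeq, changes]
  | 0, k + 1, _, _ => by simp [D, qSeq, changes]
  | 1, k, μ, h => by
    have h0 : μ 0 = a 0 := (h 0).symm
    have hc : changes a 1 = if 1 + a 0 < 0 then 1 else 0 := by simp [changes, qSeq]
    rw [hc, qSeq]
    match k with
    | 0 =>
      simp only [D, Set.mem_ofPred_eq, h0]
      constructor
      · intro h
        exact ⟨by linarith, if_neg (by linarith)⟩
      · rintro ⟨h1, h2⟩
        by_contra! h3
        have h4 : 1 + a 0 < 0 := lt_of_le_of_ne (by linarith) h1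
        simp [h4] at h2
    | 1 =>
      simp only [D, Set.mem_ofPred_eq, h0]
      constructor
      · intro h
        exact ⟨by linarith, if_pos (by linarith)⟩
      · rintro ⟨h1, h2⟩
        split_ifs at h2
        linarith
    | k + 2 =>
      simp only [D, Set.mem_empty_iff_false, false_iff]
      rintro ⟨h1, h2⟩
      split_ifs at h2
      omega
  | n + 2, k, μ, h => by
    have hl : μ (Fin.last (n + 1)) = a (n + 1) := (h (Fin.last (n + 1))).symm
    have hl' : Fin.init μ (Fin.last n) = a n := (h (Fin.last n).castSucc).symm
    have hi : ∀ i : Fin (n + 1), a i = (Fin.init μ : Fin (n + 1) → ℝ) i := fun i => h i.castSucc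
    have hii : ∀ i : Fin n, a i = (Fin.init (Fin.init μ) : Fin n → ℝ) i :=
      fun i => h i.castSucc.castSucc
    by_cases hq : qSeq a (n + 1) = 0
    · have hqn : qSeq a n ≠ 0 := (qSeq_ne_zero_or a n).resolve_right (not_not.2 hq)
      have h2 : qSeq a n * qSeq a (n + 2) < 0 := by
        rw [qSeq_of_eq_zero hq]
        have := mul_self_pos.2 hqn
        linarith
      rw [changes_add_two_of_neg h2]
      cases k with
      | zero => simp [D, epi, mem_D_iff hi, hq]
      | succ k =>
        simp only [D, epi, hypo, cylinder, graph, Set.mem_union, Set.mem_ofPred_eq, mem_D_iff hi,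
          mem_D_iff hii, hl', eq_Phi_iff hii hqn]
        simp [hq, hqn, right_ne_zero_of_mul h2.ne]
    · have hgraph : ¬ (Fin.init (Fin.init μ) : Fin n → ℝ) ∈ D n (k - 1) ∨
          a n ≠ Phi n (Fin.init (Fin.init μ)) := by
        by_contra! hcon
        exact hq ((eq_Phi_iff hii ((mem_D_iff hii).1 hcon.1).1).1 hcon.2)
      have hstep : (qSeq a (n + 1) * qSeq a (n + 2) < 0 ∧ changes a (n + 1) + 1 = k) ∨
          (0 < qSeq a (n + 1) * qSeq a (n + 2) ∧ changes a (n + 1) = k) ↔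
          qSeq a (n + 2) ≠ 0 ∧ changes a (n + 2) = k := by
        rcases lt_trichotomy (qSeq a (n + 1) * qSeq a (n + 2)) 0 with h2 | h2 | h2
        · simp [h2, h2.le, changes_succ_of_neg h2, right_ne_zero_of_mul h2.ne]
        · simp [(mul_eq_zero.1 h2).resolve_left hq]
        · simp [h2, h2.le, changes_succ_of_pos h2, right_ne_zero_of_mul h2.ne']
      rw [← hstep]
      cases k with
      | zero =>
        simp only [D, epi, Set.mem_ofPred_eq, mem_D_iff hi, hl, Phi_lt_iff hi hq]
        simp [hq, and_comm]
      | succ k =>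
        simp only [D, epi, hypo, cylinder, graph, Set.mem_union, Set.mem_ofPred_eq, mem_D_iff hi,
          hl', hl, Phi_lt_iff hi hq, lt_Phi_iff hi hq]
        rw [Nat.add_sub_cancel] at hgraph
        have : ¬ ((Fin.init (Fin.init μ) : Fin n → ℝ) ∈ D n k ∧
            a n = Phi n (Fin.init (Fin.init μ))) := by tauto
        simp only [this, or_false, hq, ne_eq, not_false_eq_true, true_and, Nat.add_right_cancel_iff]
        tauto

/-- The parameters `μ`, continued by zero. -/
def pad {n : ℕ} (μ : Fin n → ℝ) (m : ℕ) : ℝ := if h : m < n then μ ⟨m, h⟩ else 0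

theorem pad_coe {n : ℕ} (μ : Fin n → ℝ) (i : Fin n) : pad μ i = μ i := by simp [pad]

theorem pad_of_le {n m : ℕ} (μ : Fin n → ℝ) (h : n ≤ m) : pad μ m = 0 := by
  simp [pad, not_lt.2 h]

theorem pad_neg {n : ℕ} (μ : Fin n → ℝ) : pad (-μ) = -pad μ := by
  ext m
  simp only [pad, Pi.neg_apply]
  split_ifs <;> simp

theorem continuous_pad (n : ℕ) : Continuous (pad : (Fin n → ℝ) → ℕ → ℝ) := by
  refine continuous_pi fun m => ?_
  unfold pad
  split_ifs <;> fun_prop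

/-- The slope at infinity of the threshold solution of `H μ`; it vanishes exactly when that
solution is bounded. -/
def slope {p : ℕ} (μ : Fin (p + 1) → ℝ) : ℝ := qSeq (pad μ) (p + 1) - qSeq (pad μ) p

theorem mem_G_iff {p k : ℕ} {μ : Fin (p + 1) → ℝ} :
    μ ∈ G (p + 1) k ↔ slope μ ≠ 0 ∧ slopeIndex (pad μ) p = k := by
  have h : ∀ i : Fin (p + 1), bump (pad μ) p (-1) i = (μ - lastUnit (p + 1)) i := by
    intro i
    refine Fin.lastCases ?_ (fun j => ?_) i
    · have := pad_coe μ (Fin.last p)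
      rw [Fin.val_last] at this
      simp [bump, lastUnit, this, sub_eq_add_neg]
    · have := pad_coe μ j.castSucc
      rw [Fin.val_castSucc] at this
      simp [bump_of_lt, lastUnit, this, j.2.ne]
  rw [G, Set.mem_ofPred_eq, mem_D_iff h, qSeq_bump_neg_one]
  exact and_congr_right fun hs => by rw [changes_bump_neg_one hs]

/-! ### The quadratic form of the Jacobi operator -/

open Filter Topology

theorem H_apply {n : ℕ} (μ : Fin n → ℝ) (u : L2) (m : ℕ) :
    H μ u m = jacobiFun offDiag (fun _ => 2) u m + jacobiFun (fun _ => 0) (potential μ) u m := rfl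

theorem sqrt_two_mul_self : (√2 : ℂ) * (√2 : ℂ) = 2 := by
  rw [← Complex.ofReal_mul, Real.mul_self_sqrt (by norm_num)]
  norm_num

/-- The coordinates in which the off-diagonal entry `-√2` becomes `-1`: the first one is multiplied
by `√2`. -/
def toSeq : L2 →ₗ[ℂ] (ℕ → ℂ) where
  toFun u m := if m = 0 then √2 * u 0 else u m
  map_add' u v := by
    ext m
    by_cases hm : m = 0 <;> simp [hm, mul_add]
  map_smul' c u := by
    ext m
    by_cases hm : m = 0
    · simp [hm]
      ring
    · simp [hm]

theorem toSeq_zero (u : L2) : toSeq u 0 = √2 * u 0 := rfl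

theorem toSeq_succ (u : L2) (m : ℕ) : toSeq u (m + 1) = u (m + 1) := rfl

theorem sqrt_two_mul_H_apply_zero {n : ℕ} (μ : Fin n → ℝ) (u : L2) :
    √2 * H μ u 0 = 2 * ((1 + pad μ 0) * toSeq u 0 - toSeq u 1) := by
  have hp : potential μ 0 = 2 * pad μ 0 := by
    by_cases h : 0 < n <;> simp [potential, pad, h]
  rw [H_apply, toSeq_zero, toSeq_succ]
  simp only [jacobiFun, offDiag, hp, if_true]
  push_cast
  linear_combination -(u 1) * sqrt_two_mul_self

theorem H_apply_succ {n : ℕ} (μ : Fin n → ℝ) (u : L2) (m : ℕ) :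
    H μ u (m + 1) = -toSeq u m + (2 + pad μ (m + 1)) * toSeq u (m + 1) - toSeq u (m + 2) := by
  have hp : potential μ (m + 1) = pad μ (m + 1) := by
    unfold potential pad
    split_ifs <;> simp_all
  rw [H_apply, toSeq_succ, toSeq_succ]
  cases m with
  | zero =>
    rw [toSeq_zero]
    simp only [jacobiFun, offDiag, hp]
    push_cast
    simp
    ring
  | succ m =>
    rw [toSeq_succ]
    simp only [jacobiFun, offDiag, hp]
    push_cast
    simp
    ring

/-- The partial sums of `⟪H u, u⟫` are the values of the finite forms, up to a boundary term. -/
theorem sum_inner_H_apply {n : ℕ} (μ : Fin n → ℝ) (u : L2) (N : ℕ) :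
    ∑ m ∈ Finset.range (N + 1), inner ℂ (H μ u m) (u m) =
      (triForm (pad μ) (N + 1) (toSeq u) : ℂ) -
        starRingEnd ℂ (toSeq u (N + 1)) * toSeq u N := by
  induction N with
  | zero =>
    have h := congrArg (starRingEnd ℂ) (sqrt_two_mul_H_apply_zero μ u)
    simp only [map_mul, map_sub, map_add, map_one, conj_ofReal, map_ofNat] at h
    have h1 : (normSq (toSeq u 0) : ℂ) = starRingEnd ℂ (toSeq u 0) * toSeq u 0 :=
      normSq_eq_conj_mul_self
    rw [Finset.sum_range_one, RCLike.inner_apply]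
    simp only [triForm, ofReal_mul, ofReal_add, ofReal_one, h1, zero_add]
    rw [toSeq_zero] at h ⊢
    have h2 : (√2 : ℂ) ≠ 0 := by
      intro h0
      have := sqrt_two_mul_self
      simp [h0] at this
    linear_combination (1 / 2) * √2 * u 0 * h -
      (1 / 2) * starRingEnd ℂ (H μ u 0) * u 0 * sqrt_two_mul_self
  | succ N ih =>
    have h1 (z : ℂ) : (normSq z : ℂ) = starRingEnd ℂ z * z := normSq_eq_conj_mul_self
    have h2 (x y : ℂ) : 2 * ((starRingEnd ℂ x * y).re : ℂ) =
        starRingEnd ℂ x * y + starRingEnd ℂ y * x := by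
      have := add_conj (starRingEnd ℂ x * y)
      rw [map_mul, conj_conj] at this
      push_cast at this
      linear_combination -this
    rw [Finset.sum_range_succ, ih, RCLike.inner_apply, H_apply_succ, triForm, ← toSeq_succ]
    push_cast
    rw [h2, h1]
    simp only [map_sub, map_add, map_neg, map_mul, conj_ofReal, map_ofNat]
    ring

theorem tendsto_coe_zero (u : L2) : Tendsto (fun m => u m) atTop (𝓝 0) := by
  rw [tendsto_zero_iff_norm_tendsto_zero]
  have h := (summable_sq u).tendsto_atTop_zero
  simpa [Real.sqrt_sq] using h.sqrt

theorem tendsto_triForm_inner {n : ℕ} (μ : Fin n → ℝ) (u : L2) :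
    Tendsto (fun N => (triForm (pad μ) (N + 1) (toSeq u) : ℂ)) atTop
      (𝓝 (inner ℂ (H μ u) u)) := by
  have h1 := (lp.hasSum_inner (𝕜 := ℂ) (H μ u) u).tendsto_sum_nat
  have h2 := (tendsto_add_atTop_iff_nat 1).2 h1
  have h3 : Tendsto (fun m => toSeq u m) atTop (𝓝 0) := by
    rw [← tendsto_add_atTop_iff_nat 1]
    exact (tendsto_add_atTop_iff_nat (f := fun m => u m) 1).2 (tendsto_coe_zero u)
  have h4 : Tendsto (fun m => starRingEnd ℂ (toSeq u (m + 1)) * toSeq u m) atTop (𝓝 0) := by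
    have := ((continuous_conj.tendsto (0 : ℂ)).comp ((tendsto_add_atTop_iff_nat 1).2 h3)).mul h3
    simpa using this
  have h5 := h2.add h4
  rw [add_zero] at h5
  refine h5.congr fun N => ?_
  rw [sum_inner_H_apply]
  ring

theorem tendsto_triForm {n : ℕ} (μ : Fin n → ℝ) (u : L2) :
    Tendsto (fun N => triForm (pad μ) (N + 1) (toSeq u)) atTop
      (𝓝 ((H μ).reApplyInnerSelf u)) := by
  have := (continuous_re.tendsto _).comp (tendsto_triForm_inner μ u)
  exact this

/-- The quadratic form of `H μ` is real, as a limit of the real values `triForm`. -/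
theorem isSelfAdjoint_H {n : ℕ} (μ : Fin n → ℝ) : IsSelfAdjoint (H μ) := by
  rw [ContinuousLinearMap.isSelfAdjoint_iff_isSymmetric,
    LinearMap.isSymmetric_iff_inner_map_self_real]
  intro u
  have h := tendsto_triForm_inner μ u
  have h2 := (continuous_conj.tendsto _).comp h
  refine tendsto_nhds_unique h2 (h.congr fun N => ?_)
  simp

/-- The finitely supported element of `L2` with given coordinates `toSeq` on the first `N` sites. -/
def ofSeq (N : ℕ) : (ℕ → ℂ) →ₗ[ℂ] L2 :=
  ∑ m ∈ Finset.range N, (LinearMap.proj m : (ℕ → ℂ) →ₗ[ℂ] ℂ).smulRight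
    (lp.single 2 m (if m = 0 then (√2 : ℂ)⁻¹ else 1))

theorem toSeq_ofSeq {N : ℕ} {w : ℕ → ℂ} (hw : ∀ m, N ≤ m → w m = 0) :
    toSeq (ofSeq N w) = w := by
  have hs : (√2 : ℂ) ≠ 0 := by
    intro h0
    have := sqrt_two_mul_self
    simp [h0] at this
  have h (m : ℕ) : (ofSeq N w : L2) m = w m * (if m = 0 then (√2 : ℂ)⁻¹ else 1) := by
    simp only [ofSeq, LinearMap.sum_apply, LinearMap.smulRight_apply, LinearMap.proj_apply]
    rw [lp.coeFn_sum, Finset.sum_apply]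
    simp only [lp.coeFn_smul, Pi.smul_apply, lp.single_apply, Pi.single_apply]
    by_cases hm : m < N
    · rw [Finset.sum_eq_single m]
      · simp
      · intro b _ hb
        simp [hb.symm]
      · simp [hm]
    · rw [hw m (not_lt.1 hm), zero_mul]
      refine Finset.sum_eq_zero fun b hb => ?_
      have : m ≠ b := by
        rintro rfl
        exact hm (Finset.mem_range.1 hb)
      simp [this]
  ext m
  cases m with
  | zero =>
    rw [toSeq_zero, h]
    simp
    field_simp
  | succ m =>
    rw [toSeq_succ, h]
    simp

theorem reApplyInnerSelf_ofSeq {n : ℕ} (μ : Fin n → ℝ) {N : ℕ} {w : ℕ → ℂ}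
    (hw : ∀ m, N ≤ m → w m = 0) :
    (H μ).reApplyInnerSelf (ofSeq N w) = triForm (pad μ) N w := by
  have h := tendsto_triForm μ (ofSeq N w)
  rw [toSeq_ofSeq hw] at h
  refine tendsto_nhds_unique h (tendsto_const_nhds.congr' ?_)
  filter_upwards [eventually_ge_atTop N] with M hM
  rw [triForm_succ_of_eq_zero (hw M hM)]
  induction M, hM using Nat.le_induction with
  | base => rfl
  | succ M hM ih => rw [triForm_succ_of_eq_zero (hw M hM), ih]

theorem triForm_le_reApplyInnerSelf {p : ℕ} (μ : Fin (p + 1) → ℝ) (u : L2) :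
    triForm (bump (pad μ) p (-1)) (p + 1) (toSeq u) ≤ (H μ).reApplyInnerSelf u := by
  refine ge_of_tendsto ((tendsto_add_atTop_iff_nat p).2 (tendsto_triForm μ u))
    (Eventually.of_forall fun j => ?_)
  have h := le_triForm_add (a := pad μ) (p := p) (fun m hm => pad_of_le μ hm) (toSeq u) j
  have := normSq_nonneg (toSeq u (p + j))
  rw [add_comm j p]
  linarith

/-- Finitely supported sequences see the negative index of the forms `triForm (pad μ) N` with `N`
large, while the quadratic form of `H μ` dominates the form on the first sites with the bond behind
them cut; both indices are equal to the number of sign changes of the threshold solution. -/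
theorem hasNegIndex_H {p : ℕ} {μ : Fin (p + 1) → ℝ} (hs : slope μ ≠ 0) :
    HasNegIndex (H μ) (slopeIndex (pad μ) p) := by
  constructor
  · obtain ⟨N, -, hN, hc⟩ :=
      exists_changes_eq_slopeIndex (a := pad μ) (p := p) (fun m hm => pad_of_le μ hm) hs
    have h := hasNegDim_changes hN
    rw [hc] at h
    obtain ⟨e, he, hneg⟩ := h
    refine ⟨ofSeq N ∘ₗ e, fun x hx => ?_⟩
    rw [LinearMap.comp_apply, reApplyInnerSelf_ofSeq μ (he x)]
    exact hneg x hx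
  · have h := hasNonnegCodim_changes (a := bump (pad μ) p (-1)) (n := p + 1)
      (by rwa [qSeq_bump_neg_one])
    rw [changes_bump_neg_one hs] at h
    obtain ⟨l, hl⟩ := h
    exact ⟨l ∘ₗ toSeq, fun u hu => (hl _ hu).trans (triForm_le_reApplyInnerSelf μ u)⟩

/-! ### Eigenvectors -/

/-- A solution of the three-term recurrence is determined by its first value. -/
theorem eq_zero_of_eigen {n : ℕ} {μ : Fin n → ℝ} {z : ℂ} {u : L2} (hu : H μ u = z • u)
    (h0 : u 0 = 0) : u = 0 := by
  have hap (m : ℕ) : H μ u m = z * u m := by rw [hu]; simp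
  have h1 : toSeq u 0 = 0 := by rw [toSeq_zero, h0, mul_zero]
  have hw : ∀ m, toSeq u m = 0 ∧ toSeq u (m + 1) = 0 := by
    intro m
    induction m with
    | zero =>
      refine ⟨h1, ?_⟩
      have h := sqrt_two_mul_H_apply_zero μ u
      rw [hap, h0, h1] at h
      simpa using h
    | succ m ih =>
      refine ⟨ih.2, ?_⟩
      have h := H_apply_succ μ u m
      rw [hap, ← toSeq_succ, ih.1, ih.2] at h
      simpa using h
  ext m
  cases m with
  | zero => exact h0
  | succ m => exact (hw m).2

theorem eq_smul_of_eigen {n : ℕ} {μ : Fin n → ℝ} {z : ℂ} {u v : L2} (hu : H μ u = z • u)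
    (hv : H μ v = z • v) (h0 : u ≠ 0) : ∃ c : ℂ, v = c • u := by
  have hu0 : u 0 ≠ 0 := fun h => h0 (eq_zero_of_eigen hu h)
  refine ⟨v 0 / u 0, sub_eq_zero.1 (eq_zero_of_eigen (μ := μ) (z := z) ?_ ?_)⟩
  · rw [map_sub, map_smul, hu, hv, smul_sub, smul_comm]
  · rw [lp.coeFn_sub, lp.coeFn_smul]
    simp [hu0]

theorem IsEigenvalue.isSimple {n : ℕ} {μ : Fin n → ℝ} {z : ℝ} (h : IsEigenvalue (H μ) z) :
    IsSimpleEigenvalue (H μ) z := by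
  obtain ⟨u, hu⟩ := h.exists_hasEigenvector
  have hne : (⟨u, hu.1⟩ : Module.End.eigenspace (H μ : Module.End ℂ L2) (z : ℂ)) ≠ 0 :=
    fun h => hu.2 (congrArg Subtype.val h)
  refine (finrank_eq_one_iff_of_nonzero' _ hne).2 fun v => ?_
  obtain ⟨c, hc⟩ := eq_smul_of_eigen (μ := μ) (Module.End.mem_eigenspace_iff.1 hu.1)
    (Module.End.mem_eigenspace_iff.1 v.2) hu.2
  exact ⟨c, Subtype.ext hc.symm⟩

/-! ### Reflection of the upper threshold into the lower one -/

/-- The unitary involution `(U u) m = (-1)^m u m`. -/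
def alternate : L2 →ₗ[ℂ] L2 where
  toFun u := ⟨fun m => (-1) ^ m * u m, memℓp_gen (by simpa using summable_sq u)⟩
  map_add' u v := by
    ext m
    exact mul_add _ _ _
  map_smul' c u := by
    ext m
    exact mul_left_comm _ _ _

theorem alternate_apply (u : L2) (m : ℕ) : alternate u m = (-1) ^ m * u m := rfl

theorem neg_one_pow_mul_self (m : ℕ) : ((-1 : ℂ) ^ m) * (-1) ^ m = 1 := by
  rw [← mul_pow]
  simp

theorem alternate_alternate (u : L2) : alternate (alternate u) = u := by
  ext m
  rw [alternate_apply, alternate_apply, ← mul_assoc, neg_one_pow_mul_self, one_mul]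

/-- The operator `4 - H μ`. -/
def reflected {n : ℕ} (μ : Fin n → ℝ) : L2 →L[ℂ] L2 := algebraMap ℝ (L2 →L[ℂ] L2) 4 - H μ

theorem reflected_apply {n : ℕ} (μ : Fin n → ℝ) (u : L2) :
    reflected μ u = (4 : ℂ) • u - H μ u := by
  rw [reflected, Algebra.algebraMap_eq_smul_one, sub_apply, smul_apply, one_apply_eq_self]
  congr 1

theorem isSelfAdjoint_reflected {n : ℕ} (μ : Fin n → ℝ) : IsSelfAdjoint (reflected μ) :=
  isSelfAdjoint_four_sub (isSelfAdjoint_H μ)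

theorem reflected_eq {n : ℕ} (μ : Fin n → ℝ) (u : L2) :
    reflected μ u = alternate (H (-μ) (alternate u)) := by
  have hpot (m : ℕ) : potential (-μ) m = -potential μ m := by
    simp only [potential, Pi.neg_apply]
    split_ifs <;> simp
  have hs := neg_one_pow_mul_self
  ext m
  rw [reflected_apply, alternate_apply]
  change 4 * u m - H μ u m = _
  rw [H_apply, H_apply]
  cases m with
  | zero =>
    simp only [jacobiFun, hpot, alternate_apply]
    push_cast
    ring
  | succ m =>
    simp only [jacobiFun, hpot, alternate_apply, pow_succ]
    push_cast
    linear_combination (offDiag m * u m + offDiag (m + 1) * u (m + 2) - (2 - potential μ (m + 1)) *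
      u (m + 1)) * hs m

theorem reApplyInnerSelf_reflected {n : ℕ} (μ : Fin n → ℝ) (u : L2) :
    (reflected μ).reApplyInnerSelf u = (H (-μ)).reApplyInnerSelf (alternate u) := by
  rw [ContinuousLinearMap.reApplyInnerSelf_apply, ContinuousLinearMap.reApplyInnerSelf_apply,
    reflected_eq, lp.inner_eq_tsum, lp.inner_eq_tsum]
  congr 1
  refine tsum_congr fun m => ?_
  rw [RCLike.inner_apply, RCLike.inner_apply, alternate_apply, alternate_apply]
  simp only [map_mul, map_pow, map_neg, map_one]
  ring

theorem hasNegIndex_reflected {p : ℕ} {μ : Fin (p + 1) → ℝ} (hs : slope (-μ) ≠ 0) :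
    HasNegIndex (reflected μ) (slopeIndex (pad (-μ)) p) := by
  obtain ⟨⟨e, he⟩, l, hl⟩ := hasNegIndex_H hs
  refine ⟨⟨alternate ∘ₗ e, fun x hx => ?_⟩, l ∘ₗ alternate, fun u hu => ?_⟩
  · rw [reApplyInnerSelf_reflected, LinearMap.comp_apply, alternate_alternate]
    exact he x hx
  · rw [reApplyInnerSelf_reflected]
    exact hl _ hu

theorem traceAbove_eq {n : ℕ} (μ : Fin n → ℝ) :
    traceAbove (H μ) = traceSpectralProj (reflected μ) fun x => max (0 - x) 0 :=
  (traceSpectralProj_four_sub (isSelfAdjoint_H μ)).symm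

theorem traceBelow_H {p : ℕ} {μ : Fin (p + 1) → ℝ} (hs : slope μ ≠ 0) :
    traceBelow (H μ) = slopeIndex (pad μ) p :=
  (hasNegIndex_H hs).traceSpectralProj_eq (isSelfAdjoint_H μ)

theorem traceAbove_H {p : ℕ} {μ : Fin (p + 1) → ℝ} (hs : slope (-μ) ≠ 0) :
    traceAbove (H μ) = slopeIndex (pad (-μ)) p := by
  rw [traceAbove_eq]
  exact (hasNegIndex_reflected hs).traceSpectralProj_eq (isSelfAdjoint_reflected μ)

theorem hasExactlyEigenvaluesIn_Iio_iff {p : ℕ} {μ : Fin (p + 1) → ℝ} (hs : slope μ ≠ 0)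
    (k : ℕ) : HasExactlyEigenvaluesIn (H μ) (Set.Iio 0) k ↔ slopeIndex (pad μ) p = k := by
  have h := (hasNegIndex_H hs).encard_eigenvalues (isSelfAdjoint_H μ)
    fun z u v hu hv h0 => eq_smul_of_eigen hu hv h0
  change Set.encard {z : ℝ | z < 0 ∧ _} = _ ↔ _
  rw [← Nat.cast_inj (R := ℕ∞), ← h]
  rfl

theorem hasExactlyEigenvaluesIn_Ioi_iff {p : ℕ} {μ : Fin (p + 1) → ℝ} (hs : slope (-μ) ≠ 0)
    (k : ℕ) : HasExactlyEigenvaluesIn (H μ) (Set.Ioi 4) k ↔ slopeIndex (pad (-μ)) p = k := by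
  have hiff (z : ℝ) (u : L2) : H μ u = ((4 - z : ℝ) : ℂ) • u ↔ reflected μ u = (z : ℂ) • u := by
    rw [reflected_apply, sub_eq_iff_eq_add, ← sub_eq_iff_eq_add', ← sub_smul]
    push_cast
    exact eq_comm
  have hev (z : ℝ) : IsEigenvalue (H μ) (4 - z) ↔
      Module.End.HasEigenvalue (reflected μ : Module.End ℂ L2) (z : ℂ) := by
    constructor
    · intro h
      obtain ⟨u, hu⟩ := h.exists_hasEigenvector
      exact Module.End.hasEigenvalue_of_hasEigenvector (x := u)
        ⟨Module.End.mem_eigenspace_iff.2 ((hiff z u).1 hu.apply_eq_smul), hu.2⟩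
    · intro h
      obtain ⟨u, hu⟩ := h.exists_hasEigenvector
      exact Module.End.hasEigenvalue_of_hasEigenvector (x := u)
        ⟨Module.End.mem_eigenspace_iff.2 ((hiff z u).2 hu.apply_eq_smul), hu.2⟩
  have h := (hasNegIndex_reflected hs).encard_eigenvalues (isSelfAdjoint_reflected μ)
    fun z u v hu hv h0 => eq_smul_of_eigen ((hiff z u).2 hu) ((hiff z v).2 hv) h0
  have himage : {z : ℝ | z ∈ Set.Ioi 4 ∧ IsEigenvalue (H μ) z} = (fun z : ℝ => 4 - z) ''
      {z : ℝ | z < 0 ∧ Module.End.HasEigenvalue (reflected μ : Module.End ℂ L2) (z : ℂ)} := by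
    ext z
    constructor
    · rintro ⟨hz, h⟩
      have hz' : 4 < z := hz
      refine ⟨4 - z, ⟨by linarith, (hev _).1 ?_⟩, by simp⟩
      rwa [sub_sub_cancel]
    · rintro ⟨y, ⟨hy, h⟩, rfl⟩
      exact ⟨show (4 : ℝ) < 4 - y by linarith, (hev y).2 h⟩
  rw [HasExactlyEigenvaluesIn, himage, sub_right_injective.encard_image, h, Nat.cast_inj]

/-! ### Critical parameters -/

theorem slopeIndex_eventually_eq {p : ℕ} {μ : Fin (p + 1) → ℝ} (hs : slope μ ≠ 0) :
    ∀ᶠ ν in 𝓝 μ, slope ν ≠ 0 ∧ slopeIndex (pad ν) p = slopeIndex (pad μ) p := by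
  have hpad := continuous_pad (p + 1)
  have hslope : Continuous (slope : (Fin (p + 1) → ℝ) → ℝ) :=
    ((continuous_qSeq (p + 1)).comp hpad).sub ((continuous_qSeq p).comp hpad)
  have hb : Continuous fun ν : Fin (p + 1) → ℝ => bump (pad ν) p (-1) :=
    hpad.update p (((continuous_apply p).comp hpad).add continuous_const)
  have hq : qSeq (bump (pad μ) p (-1)) (p + 1) ≠ 0 := by rwa [qSeq_bump_neg_one]
  filter_upwards [hslope.continuousAt.eventually_ne hs,
    hb.continuousAt.eventually (changes_eventually_eq hq)] with ν hν hc
  exact ⟨hν, by rwa [changes_bump_neg_one hs, changes_bump_neg_one hν] at hc⟩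

/-- A function that is given by the number of sign changes away from `slope = 0` jumps exactly where
the slope vanishes: there, moving the last parameter up or down makes the slope nonzero, with the
two possible signs relative to the last value of the solution. -/
theorem continuousAt_iff_slope_ne_zero {p : ℕ} {g : (Fin (p + 1) → ℝ) → ℕ∞}
    (hg : ∀ ν, slope ν ≠ 0 → g ν = slopeIndex (pad ν) p) (μ : Fin (p + 1) → ℝ) :
    ContinuousAt g μ ↔ slope μ ≠ 0 := by
  constructor
  · intro hc h0
    have hq : qSeq (pad μ) p ≠ 0 := by
      intro h
      have h1 : qSeq (pad μ) (p + 1) = 0 := by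
        rw [slope, h, sub_zero] at h0
        exact h0
      exact (qSeq_ne_zero_or (pad μ) p).elim (fun h2 => h2 h) fun h2 => h2 h1
    set c : ℝ → Fin (p + 1) → ℝ := fun t => Function.update μ (Fin.last p) (μ (Fin.last p) + t)
    have hc0 : c 0 = μ := by simp [c]
    have hcont : Continuous c := continuous_const.update _ (by fun_prop)
    have hpad (t : ℝ) : pad (c t) = bump (pad μ) p t := by
      ext m
      rcases lt_trichotomy m p with hm | rfl | hm
      · have : (⟨m, by omega⟩ : Fin (p + 1)) ≠ Fin.last p := fun h => hm.ne (congrArg Fin.val h)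
        simp [pad, bump_of_lt t hm, c, show m < p + 1 by omega, this]
      · simp [pad, bump, c, Fin.last]
      · rw [pad_of_le _ hm, bump, Function.update_of_ne hm.ne', pad_of_le _ hm]
    have hslope (t : ℝ) : slope (c t) = t * qSeq (pad μ) p := by
      rw [slope, hpad, qSeq_bump, qSeq_bump_self]
      unfold slope at h0
      linarith
    have hindex (t : ℝ) : slopeIndex (pad (c t)) p =
        changes (pad μ) p + if t * (qSeq (pad μ) p * qSeq (pad μ) p) ≤ 0 then 1 else 0 := by
      have := hslope t
      unfold slope at this
      rw [slopeIndex, this, hpad, changes_bump_self, qSeq_bump_self, mul_assoc]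
    have hq2 : 0 < qSeq (pad μ) p * qSeq (pad μ) p := mul_self_pos.2 hq
    have hlim : Tendsto (fun t => g (c t)) (𝓝 0) (𝓝 (g μ)) := by
      have h1 : ContinuousAt g (c 0) := hc0 ▸ hc
      have h2 : ContinuousAt (fun t => g (c t)) 0 :=
        ContinuousAt.comp (f := c) (g := g) h1 hcont.continuousAt
      simpa [ContinuousAt, hc0] using h2
    have hright : g μ = (changes (pad μ) p : ℕ∞) := by
      refine tendsto_nhds_unique (hlim.mono_left (nhdsWithin_le_nhds (s := Set.Ioi 0)))
        (tendsto_const_nhds.congr' ?_)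
      filter_upwards [self_mem_nhdsWithin] with t ht
      have ht' : 0 < t := ht
      rw [hg _ (by rw [hslope]; exact mul_ne_zero ht'.ne' hq), hindex,
        if_neg (not_le.2 (mul_pos ht' hq2)), add_zero]
    have hleft : g μ = ((changes (pad μ) p + 1 : ℕ) : ℕ∞) := by
      refine tendsto_nhds_unique (hlim.mono_left (nhdsWithin_le_nhds (s := Set.Iio 0)))
        (tendsto_const_nhds.congr' ?_)
      filter_upwards [self_mem_nhdsWithin] with t ht
      have ht' : t < 0 := ht
      rw [hg _ (by rw [hslope]; exact mul_ne_zero ht'.ne hq), hindex,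
        if_pos (mul_neg_of_neg_of_pos ht' hq2).le]
    rw [hright, Nat.cast_inj] at hleft
    omega
  · intro hs
    refine continuousAt_const.congr (f := fun _ => (slopeIndex (pad μ) p : ℕ∞)) ?_
    filter_upwards [slopeIndex_eventually_eq hs] with ν hν
    rw [hg ν hν.1, hν.2]

theorem not_criticalLower_iff {p : ℕ} {μ : Fin (p + 1) → ℝ} :
    ¬ CriticalLower μ ↔ slope μ ≠ 0 := by
  rw [CriticalLower, not_not]
  exact continuousAt_iff_slope_ne_zero (fun ν hν => traceBelow_H hν) μ

theorem not_criticalUpper_iff {p : ℕ} {μ : Fin (p + 1) → ℝ} :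
    ¬ CriticalUpper μ ↔ slope (-μ) ≠ 0 := by
  rw [CriticalUpper, not_not, ← continuousAt_iff_slope_ne_zero
    (g := fun ν => traceAbove (H (-ν))) (fun ν hν => ?_) (-μ)]
  · constructor
    · intro h
      have h' : ContinuousAt (fun ν : Fin (p + 1) → ℝ => traceAbove (H ν)) (- -μ) := by
        rwa [neg_neg]
      exact ContinuousAt.comp (f := fun ν : Fin (p + 1) → ℝ => -ν) h'
        continuous_neg.continuousAt
    · intro h
      have := ContinuousAt.comp (f := fun ν : Fin (p + 1) → ℝ => -ν) h
        continuous_neg.continuousAt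
      simpa [Function.comp_def] using this
  · rw [traceAbove_H (by rwa [neg_neg]), neg_neg]

end JacobiVirtual

end

theorem mainTheorem1 (n : ℕ) (hn : 1 ≤ n) (μ : Fin n → ℝ) :
    (JacobiVirtual.Noncritical μ →
      (∀ z ∈ Set.Iio (0 : ℝ) ∪ Set.Ioi 4, JacobiVirtual.IsEigenvalue (JacobiVirtual.H μ) z →
        JacobiVirtual.IsSimpleEigenvalue (JacobiVirtual.H μ) z) ∧
      (∀ k ≤ n, JacobiVirtual.HasExactlyEigenvaluesIn (JacobiVirtual.H μ) (Set.Iio 0) k ↔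
        μ ∈ JacobiVirtual.G n k) ∧
      (∀ l ≤ n, JacobiVirtual.HasExactlyEigenvaluesIn (JacobiVirtual.H μ) (Set.Ioi 4) l ↔
        -μ ∈ JacobiVirtual.G n l)) ∧
    (∀ k ≤ n, ∀ l ≤ n,
      (JacobiVirtual.Noncritical μ ∧ k + l ≤ n ∧
        JacobiVirtual.HasExactlyEigenvaluesIn (JacobiVirtual.H μ) (Set.Iio 0) k ∧
        JacobiVirtual.HasExactlyEigenvaluesIn (JacobiVirtual.H μ) (Set.Ioi 4) l) ↔
      μ ∈ JacobiVirtual.G n k ∩ -JacobiVirtual.G n l) := by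
  obtain ⟨p, rfl⟩ : ∃ p, n = p + 1 := ⟨n - 1, by omega⟩
  have hnon : JacobiVirtual.Noncritical μ ↔
      JacobiVirtual.slope μ ≠ 0 ∧ JacobiVirtual.slope (-μ) ≠ 0 :=
    and_congr JacobiVirtual.not_criticalLower_iff JacobiVirtual.not_criticalUpper_iff
  simp only [hnon, Set.mem_inter_iff, Set.mem_neg, JacobiVirtual.mem_G_iff]
  refine ⟨?_, fun k _ l _ => ⟨?_, ?_⟩⟩
  · rintro ⟨hs, hs'⟩
    refine ⟨fun z _ hz => hz.isSimple, fun k _ => ?_, fun l _ => ?_⟩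
    · rw [JacobiVirtual.hasExactlyEigenvaluesIn_Iio_iff hs, and_iff_right hs]
    · rw [JacobiVirtual.hasExactlyEigenvaluesIn_Ioi_iff hs', and_iff_right hs']
  · rintro ⟨⟨hs, hs'⟩, -, hk, hl⟩
    exact ⟨⟨hs, (JacobiVirtual.hasExactlyEigenvaluesIn_Iio_iff hs k).1 hk⟩,
      hs', (JacobiVirtual.hasExactlyEigenvaluesIn_Ioi_iff hs' l).1 hl⟩
  · rintro ⟨⟨hs, hk⟩, hs', hl⟩
    refine ⟨⟨hs, hs'⟩, ?_, (JacobiVirtual.hasExactlyEigenvaluesIn_Iio_iff hs k).2 hk,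
      (JacobiVirtual.hasExactlyEigenvaluesIn_Ioi_iff hs' l).2 hl⟩
    rw [← hk, ← hl, JacobiVirtual.pad_neg]
    refine JacobiVirtual.slopeIndex_add_le hs ?_
    rw [← JacobiVirtual.pad_neg]
    exact hs'
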